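/- **Setting.** Let $G=(V,E)$ be a finite undirected graph with non-negative edge weights (multi-edges and loops are allowed; an edge is present if its weight is non-zero), let $\gamma>0$ and $\theta>0$. Every node of $G$ has size $\|v\|=1$. For sets of nodes, $\|C\|=\sum_{v\in C}\|v\|$, and $E(C,D)$ is the total weight of the edges with one end in $C$ and the other in $D$, each edge counted once. The quality (Constant Potts Model) of a partition $\mathcal P$ is $$\mathcal H(G,\mathcal P)=\sum_{C\in\mathcal P}\Bigl[E(C,C)-\gamma\binom{\|C\|}{2}\Bigr].$$ For a set $S$ of nodes and $D\in\mathcal P\cup\{\emptyset\}$, $\mathcal P(S\mapsto D)$ is the partition obtained by moving $S$ to $D$ (to a new community if $D=\emptyset$), and $\Delta\mathcal H_{\mathcal P}(S\mapsto D)=\mathcal H(\mathcal P(S\mapsto D))-\mathcal H(\mathcal P)$. A partition $\mathcal P$ is *subset optimal* if $\Delta\mathcal H_{\mathcal P}(S\mapsto D)\le 0$ for all $C\in\mathcal P$, all $S\subseteq C$ and all $D\in\mathcal P\cup\{\emptyset\}$. **The Leiden algorithm.** $\mathrm{Leiden}(G,\mathcal P)$ repeats the following round, starting from $G$ and $\mathcal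 P$. 1. *Local moving.* A queue is filled with all nodes in uniformly random order. While it is non-empty, its first node $v$ is removed and a community $C'\in\mathcal P\cup\{\emptyset\}$ maximising $\Delta\mathcal H_{\mathcal P}(v\mapsto C')$ is chosen; if this maximum is $>0$, then $v$ is moved to $C'$, and all neighbours of $v$ that are neither in the new community of $v$ nor in the queue are appended to the queue. Ties in the maximisation, and the order of the appended nodes, are resolved by an arbitrary fixed (possibly randomised) rule. 2. *Stopping.* If $|\mathcal P|=|V(G)|$, the algorithm ends and returns $\mathcal P$ with every community replaced by the set of nodes of the original graph that it contains. 3. *Refinement.* Let $\mathcal R$ be the partition into singletons. For each $S\in\mathcal P$ (in random order), visit the nodes $v\in S$ with $E(v,S\setminus v)\ge\gamma\|v\|(\|S\|-\|v\|)$ in uniformly random order. If $\{v\}\in\mathcal R$ when $v$ is visited, then $v$ is moved to a random $C\in\mathcal R$ with $C\subseteq S$, $E(C,S\setminus C)\ge\gamma\|C\|(\|S\|-\|C\|)$ and $\Delta\mathcal H_{\mathcal R}(v\mapsto C)\ge 0$, chosen with probability proportional to $\exp\bigl(\tfrac1\theta\Delta\mathcal H_{\mathcal R}(v\mapsto C)\bigr)$.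 4. *Aggregation.* $G$ is replaced by the graph with node set $\mathcal R$, in which the edge weight between $C$ and $D$ is $E(C,D)$ (with loops of weight $E(C,C)$) and the size of $C$ is $\|C\|$; $\mathcal P$ is replaced by the partition of $\mathcal R$ that it induces. All random choices are independent. Iterating the algorithm from a partition $\mathcal P_0$ of the nodes of $G$ gives a Markov chain $\mathcal P_{t+1}=\mathrm{Leiden}(G,\mathcal P_t)$. (If an iteration does not end, that iterate and all later ones are recorded as undefined.) A partition $\mathcal P$ is *asymptotically stable* if, when $\mathcal P_0=\mathcal P$, almost surely $\mathcal P_t=\mathcal P$ for all $t\ge 0$. **Theorem.** Let $\mathcal P$ be a partition of the nodes of $G$. Then $\mathcal P$ is asymptotically stable if and only if $\mathcal P$ is subset optimal. The same holds along almost every run: if $\mathcal P_0=\mathcal P$, then almost surely, for every $\tau$ for which $\mathcal P_\tau$ is defined, $\mathcal P_t=\mathcal P_\tau$ for all $t\ge\tau$ if and only if $\mathcal P_\tau$ is subset optimal. -/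

import Mathlib

open Finset MeasureTheory ProbabilityTheory
open scoped ENNReal

noncomputable section

namespace Leiden

universe u

/-! ### Weighted graphs, partitions and the Constant Potts Model -/

/-- A finite undirected weighted (multi)graph whose nodes are elements of `α`. An edge between
`u` and `v`, loops included, is recorded by the weight of the unordered pair `s(u, v)`; this is the
number of parallel edges if the weights count edges. `size v` is the recursive size of `v`. -/
structure WGraph (α : Type u) where
  nodes : Finset α
  weight : Sym2 α → ℝ
  size : α → ℕ

variable {α : Type u} [DecidableEq α]

/-- `E(C, D)`: the total weight of the edges with one end in `C` and the other in `D`, every edge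
being counted once. -/
def edgeWeight (G : WGraph α) (C D : Finset α) : ℝ :=
  ∑ e ∈ G.nodes.sym2 with ∃ u ∈ C, ∃ v ∈ D, e = s(u, v), G.weight e

theorem edgeWeight_comm (G : WGraph α) (C D : Finset α) :
    edgeWeight G C D = edgeWeight G D C := by
  unfold edgeWeight
  congr 1
  ext e
  simp only [Finset.mem_filter, and_congr_right_iff]
  intro _
  constructor
  · rintro ⟨u, hu, v, hv, rfl⟩
    exact ⟨v, hv, u, hu, Sym2.eq_swap⟩
  · rintro ⟨u, hu, v, hv, rfl⟩
    exact ⟨v, hv, u, hu, Sym2.eq_swap⟩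

/-- The recursive size of a set of nodes. -/
def setSize (G : WGraph α) (C : Finset α) : ℕ := ∑ v ∈ C, G.size v

/-- The Constant Potts Model with resolution `γ`. -/
def quality (γ : ℝ) (G : WGraph α) (P : Finset (Finset α)) : ℝ :=
  ∑ C ∈ P, (edgeWeight G C C - γ * ((setSize G C).choose 2 : ℕ))

/-- `P(S ↦ D)`: the partition obtained from `P` by moving all nodes of `S` to the community `D`;
`D = ∅` stands for a new community. Communities that become empty disappear. -/
def move (P : Finset (Finset α)) (S D : Finset α) : Finset (Finset α) :=
  (insert (D ∪ S) ((P.erase D).image (fun C => C \ S))).erase ∅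

/-- `ΔH_P(S ↦ D)`. -/
def gain (γ : ℝ) (G : WGraph α) (P : Finset (Finset α)) (S D : Finset α) : ℝ :=
  quality γ G (move P S D) - quality γ G P

/-- No subset of any community can be moved to another community of `P`, or to an empty community,
with a strict gain in quality. -/
def SubsetOptimal (γ : ℝ) (G : WGraph α) (P : Finset (Finset α)) : Prop :=
  ∀ C ∈ P, ∀ S ⊆ C, ∀ D ∈ insert ∅ P, gain γ G P S D ≤ 0

/-- The partition of `G` into singletons. -/
def singletonPartition (G : WGraph α) : Finset (Finset α) := G.nodes.image (fun v => {v})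

/-! ### Random orders and unspecified choices -/

/-- A uniformly random order of the elements of `s`. -/
def uniformOrder {ι : Type*} [DecidableEq ι] (s : Finset ι) : PMF (List ι) :=
  PMF.uniformOfFinset s.toList.permutations.toFinset
    ⟨s.toList, List.mem_toFinset.2 (List.mem_permutations.2 (List.Perm.refl _))⟩

/-- The choices that the pseudo-code leaves open in the local moving phase: which maximiser
`argmax` returns in case of ties, and in which order a set of nodes is appended to the queue. Both
may be random. -/
structure Choices (γ : ℝ) (α : Type u) [DecidableEq α] where
  best : WGraph α → Finset (Finset α) → α → PMF (Finset α)
  best_mem : ∀ G P v, ∀ C ∈ (best G P v).support, C ∈ insert ∅ P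
  best_max : ∀ G P v, ∀ C ∈ (best G P v).support, ∀ D ∈ insert ∅ P,
    gain γ G P {v} D ≤ gain γ G P {v} C
  order : Finset α → PMF (List α)
  order_spec : ∀ s, ∀ L ∈ (order s).support, L.Nodup ∧ L.toFinset = s

/-! ### Local moving of nodes -/

open scoped Classical in
/-- The number of sets of communities of higher quality than `P`; it bounds the number of strict
improvements. -/
def numBetter [Fintype α] (γ : ℝ) (G : WGraph α) (P : Finset (Finset α)) : ℕ :=
  #{P' : Finset (Finset α) | quality γ G P < quality γ G P'}

theorem numBetter_move_lt [Fintype α] {γ : ℝ} {G : WGraph α} {P : Finset (Finset α)}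
    {S D : Finset α} (h : 0 < gain γ G P S D) :
    numBetter γ G (move P S D) < numBetter γ G P := by
  have h' : quality γ G P < quality γ G (move P S D) := by
    unfold gain at h
    linarith
  unfold numBetter
  apply Finset.card_lt_card
  rw [Finset.ssubset_iff_of_subset]
  · exact ⟨move P S D, by simpa using h', by simp⟩
  · intro P' hP'
    simp only [Finset.mem_filter, Finset.mem_univ, true_and] at hP' ⊢
    exact h'.trans hP'

open scoped Classical in
/-- The neighbours of `v` that are not in `C`. -/
def neighborsOutside (G : WGraph α) (v : α) (C : Finset α) : Finset α :=
  {u ∈ G.nodes | G.weight s(u, v) ≠ 0 ∧ u ∉ C}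

open scoped Classical in
/-- The loop of `MoveNodesFast`, started from the partition `P` with queue `Q`. -/
def moveLoop [Fintype α] (γ : ℝ) (c : Choices γ α) (G : WGraph α) :
    Finset (Finset α) → List α → PMF (Finset (Finset α))
  | P, [] => PMF.pure P
  | P, v :: Q => (c.best G P v).bind fun C =>
      if _h : 0 < gain γ G P {v} C then
        (c.order (neighborsOutside G v (insert v C) \ Q.toFinset)).bind fun L =>
          moveLoop γ c G (move P {v} C) (Q ++ L)
      else moveLoop γ c G P Q
termination_by P Q => (numBetter γ G P, Q.length)
decreasing_by
  · exact Prod.Lex.left _ _ (numBetter_move_lt _h)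
  · exact Prod.Lex.right _ (by simp)

/-- `MoveNodesFast`: the queue initially holds all nodes in random order. -/
def moveNodesFast [Fintype α] (γ : ℝ) (c : Choices γ α) (G : WGraph α) (P : Finset (Finset α)) :
    PMF (Finset (Finset α)) :=
  (uniformOrder G.nodes).bind fun Q => moveLoop γ c G P Q

/-! ### Refinement -/

/-- `C ⊆ S` is well connected to the rest of `S`. -/
def WellConnected (γ : ℝ) (G : WGraph α) (S C : Finset α) : Prop :=
  γ * setSize G C * ((setSize G S : ℝ) - setSize G C) ≤ edgeWeight G C (S \ C)

open scoped Classical in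
/-- The communities of `R` with which the node `v` can be merged inside `S`. -/
def mergeTargets (γ : ℝ) (G : WGraph α) (S : Finset α) (R : Finset (Finset α)) (v : α) :
    Finset (Finset α) :=
  {C ∈ R | C ⊆ S ∧ WellConnected γ G S C ∧ 0 ≤ gain γ G R {v} C}

/-- The unnormalised probability that `v` is merged with `C`. -/
def mergeWeight (γ θ : ℝ) (G : WGraph α) (S : Finset α) (R : Finset (Finset α)) (v : α)
    (C : Finset α) : ℝ≥0∞ :=
  if C ∈ mergeTargets γ G S R v then ENNReal.ofReal (Real.exp (gain γ G R {v} C / θ)) else 0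

theorem tsum_mergeWeight_ne_zero {γ θ : ℝ} {G : WGraph α} {S : Finset α}
    {R : Finset (Finset α)} {v : α} (h : (mergeTargets γ G S R v).Nonempty) :
    ∑' C, mergeWeight γ θ G S R v C ≠ 0 := by
  obtain ⟨C, hC⟩ := h
  intro h0
  have := ENNReal.tsum_eq_zero.1 h0 C
  simp only [mergeWeight, hC, if_true, ENNReal.ofReal_eq_zero] at this
  exact absurd (Real.exp_pos _) (not_lt.2 this)

theorem tsum_mergeWeight_ne_top {γ θ : ℝ} {G : WGraph α} {S : Finset α}
    {R : Finset (Finset α)} {v : α} :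
    ∑' C, mergeWeight γ θ G S R v C ≠ ∞ := by
  rw [tsum_eq_sum (s := mergeTargets γ G S R v) (fun C hC => by simp [mergeWeight, hC])]
  refine ENNReal.sum_ne_top.2 fun C _ => ?_
  unfold mergeWeight
  split_ifs
  · exact ENNReal.ofReal_ne_top

open scoped Classical in
/-- The visit of one node `v` in `MergeNodesSubset`: if `v` is still on its own, it is merged with
a random community, chosen with probability proportional to `exp (ΔH / θ)`. For a well-connected
node `v` on its own, the community `{v}` is itself a target, so that the last case is void. -/
def mergeNode (γ θ : ℝ) (G : WGraph α) (S : Finset α) (R : Finset (Finset α)) (v : α) :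
    PMF (Finset (Finset α)) :=
  if {v} ∈ R then
    if h : (mergeTargets γ G S R v).Nonempty then
      (PMF.normalize (mergeWeight γ θ G S R v) (tsum_mergeWeight_ne_zero h)
        tsum_mergeWeight_ne_top).bind fun C => PMF.pure (move R {v} C)
    else PMF.pure R
  else PMF.pure R

open scoped Classical in
/-- `MergeNodesSubset`: the nodes that are well connected within `S` are visited in random
order. -/
def mergeNodesSubset (γ θ : ℝ) (G : WGraph α) (R : Finset (Finset α)) (S : Finset α) :
    PMF (Finset (Finset α)) :=
  (uniformOrder {v ∈ S | WellConnected γ G S {v}}).bind fun L =>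
    L.foldlM (mergeNode γ θ G S) R

/-- `RefinePartition`. -/
def refinePartition (γ θ : ℝ) (G : WGraph α) (P : Finset (Finset α)) :
    PMF (Finset (Finset α)) :=
  (uniformOrder P).bind fun L =>
    L.foldlM (mergeNodesSubset γ θ G) (singletonPartition G)

/-! ### Aggregation

Nodes at all levels of aggregation are represented by their flattenings, which are sets of nodes of
the base graph: a node of the base graph by a singleton, and a node of an aggregate graph, which is
a community of nodes of the preceding graph, by the union of these nodes. -/

variable {V : Type u} [DecidableEq V]

/-- The graph with the given node set in which a node `A` stands for the set of nodes `mem A` of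
`G`. -/
def aggregateBy {β : Type*} (G : WGraph α) (nodes : Finset β) (mem : β → Finset α) : WGraph β where
  nodes := nodes
  weight := Sym2.lift ⟨fun A B => edgeWeight G (mem A) (mem B), fun _ _ => edgeWeight_comm _ _ _⟩
  size A := setSize G (mem A)

/-- The flattening of a set of nodes. -/
def flatten (C : Finset (Finset V)) : Finset V := C.biUnion id

/-- The nodes of `G` that are contained in `A`. -/
def members (G : WGraph (Finset V)) (A : Finset V) : Finset (Finset V) := {v ∈ G.nodes | v ⊆ A}

/-- `AggregateGraph`: the communities of `R` become the nodes. -/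
def aggregateGraph (G : WGraph (Finset V)) (R : Finset (Finset (Finset V))) : WGraph (Finset V) :=
  aggregateBy G (R.image flatten) (members G)

/-- The base graph, with each node `v` represented as `{v}`. -/
def liftGraph (G : WGraph V) : WGraph (Finset V) :=
  aggregateBy G (G.nodes.image fun v => {v}) id

/-- A flat partition, with each node `v` represented as `{v}`. -/
def liftPartition (P : Finset (Finset V)) : Finset (Finset (Finset V)) :=
  P.image fun C => C.image fun v => {v}

/-! ### The Leiden algorithm -/

variable [Fintype V]

open scoped Classical in
/-- One round of the main loop, from the current graph and partition: either a graph and a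
partition for the next round or, if every community consists of one node, the flattened
partition. -/
def leidenRound (γ θ : ℝ) (c : Choices γ (Finset V))
    (s : WGraph (Finset V) × Finset (Finset (Finset V))) :
    PMF ((WGraph (Finset V) × Finset (Finset (Finset V))) ⊕ Finset (Finset V)) :=
  (moveNodesFast γ c s.1 s.2).bind fun P =>
    if #P = #s.1.nodes then PMF.pure (Sum.inr (P.image flatten))
    else (refinePartition γ θ s.1 P).bind fun R =>
      let G' := aggregateGraph s.1 R
      PMF.pure (Sum.inl (G', P.image fun C => members G' (flatten C)))

/-- The result after at most `n` rounds, `none` if the loop has not ended by then. -/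
def leidenRounds (γ θ : ℝ) (c : Choices γ (Finset V)) :
    ℕ → WGraph (Finset V) × Finset (Finset (Finset V)) → PMF (Option (Finset (Finset V)))
  | 0, _ => PMF.pure none
  | n + 1, s => (leidenRound γ θ c s).bind
      (Sum.elim (leidenRounds γ θ c n) fun P => PMF.pure (some P))

theorem leidenRounds_mono (γ θ : ℝ) (c : Choices γ (Finset V)) (P : Finset (Finset V)) (n : ℕ) :
    ∀ s, leidenRounds γ θ c n s (some P) ≤ leidenRounds γ θ c (n + 1) s (some P) := by
  induction n with
  | zero => intro s; simp [leidenRounds]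
  | succ n ih =>
    intro s
    rw [leidenRounds, leidenRounds, PMF.bind_apply, PMF.bind_apply]
    refine ENNReal.tsum_le_tsum fun x => mul_le_mul_right ?_ _
    rcases x with t | Q
    · exact ih t
    · exact le_rfl

theorem leidenRounds_anti (γ θ : ℝ) (c : Choices γ (Finset V)) (n : ℕ) :
    ∀ s, leidenRounds γ θ c (n + 1) s none ≤ leidenRounds γ θ c n s none := by
  induction n with
  | zero =>
    intro s
    refine (PMF.coe_le_one _ _).trans ?_
    simp [leidenRounds]
  | succ n ih =>
    intro s
    rw [leidenRounds, leidenRounds, PMF.bind_apply, PMF.bind_apply]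
    refine ENNReal.tsum_le_tsum fun x => mul_le_mul_right ?_ _
    rcases x with t | Q
    · exact ih t
    · exact le_rfl

/-- The probability that the main loop, started from `s`, ends with the given result; `none` means
that it does not end. -/
def leidenMass (γ θ : ℝ) (c : Choices γ (Finset V))
    (s : WGraph (Finset V) × Finset (Finset (Finset V))) : Option (Finset (Finset V)) → ℝ≥0∞
  | none => ⨅ n, leidenRounds γ θ c n s none
  | some P => ⨆ n, leidenRounds γ θ c n s (some P)

theorem sum_leidenMass (γ θ : ℝ) (c : Choices γ (Finset V))
    (s : WGraph (Finset V) × Finset (Finset (Finset V))) :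
    ∑ o, leidenMass γ θ c s o = 1 := by
  have h : Filter.Tendsto (fun n => ∑ o, leidenRounds γ θ c n s o) Filter.atTop
      (nhds (∑ o, leidenMass γ θ c s o)) := by
    refine tendsto_finsetSum _ fun o _ => ?_
    rcases o with _ | P
    · exact tendsto_atTop_iInf (antitone_nat_of_succ_le fun n => leidenRounds_anti γ θ c n s)
    · exact tendsto_atTop_iSup (monotone_nat_of_le_succ fun n => leidenRounds_mono γ θ c P n s)
  refine tendsto_nhds_unique h ?_
  have h1 : ∀ n, ∑ o, leidenRounds γ θ c n s o = 1 := fun n => by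
    rw [← tsum_fintype (L := .unconditional _)]
    exact PMF.tsum_coe _
  simp only [h1]
  exact tendsto_const_nhds

/-- The law of `Leiden(G, P)`. -/
def leiden (γ θ : ℝ) (c : Choices γ (Finset V)) (G : WGraph V) (P : Finset (Finset V)) :
    PMF (Option (Finset (Finset V))) :=
  PMF.ofFintype (leidenMass γ θ c (liftGraph G, liftPartition P)) (sum_leidenMass γ θ c _)

/-! ### Iterating the algorithm -/

/-- The result of some iterations of the algorithm: a partition, or `none` if one of the iterations
did not end. -/
abbrev Outcome (V : Type u) : Type u := Option (Finset (Finset V))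

instance : MeasurableSpace (Outcome V) := ⊤

instance : DiscreteMeasurableSpace (Outcome V) := ⟨fun _ => trivial⟩

/-- The transition kernel of the Markov chain `P₀, P₁, …` with `P_{t+1} = Leiden(G, P_t)`. -/
def leidenKernel (γ θ : ℝ) (c : Choices γ (Finset V)) (G : WGraph V) :
    Kernel (Outcome V) (Outcome V) :=
  Kernel.ofFunOfCountable fun o => (o.elim (PMF.pure none) (leiden γ θ c G)).toMeasure

instance (γ θ : ℝ) (c : Choices γ (Finset V)) (G : WGraph V) :
    IsMarkovKernel (leidenKernel γ θ c G) :=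
  ⟨fun o => inferInstanceAs
    (IsProbabilityMeasure (o.elim (PMF.pure none) (leiden γ θ c G)).toMeasure)⟩

/-- The law of the random sequence `P₀, P₁, …` with `P₀ = P` and `P_{t+1} = Leiden(G, P_t)`. -/
def leidenSequence (γ θ : ℝ) (c : Choices γ (Finset V)) (G : WGraph V) (P : Finset (Finset V)) :
    Measure (ℕ → Outcome V) :=
  Kernel.trajMeasure (X := fun _ => Outcome V) (Measure.dirac (some P)) fun n =>
    (leidenKernel γ θ c G).comap (fun h => h ⟨n, Finset.mem_Iic.2 le_rfl⟩)
      (measurable_pi_apply _)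

/-- `P` is asymptotically stable: when the algorithm is iterated from `P`, then almost surely all
iterates equal `P`. -/
def AsymptoticallyStable (γ θ : ℝ) (c : Choices γ (Finset V)) (G : WGraph V)
    (P : Finset (Finset V)) : Prop :=
  ∀ᵐ X ∂(leidenSequence γ θ c G P), ∀ t, X t = some P

/-- The base graph with node set `V` and the given edge weights; every node has size one. -/
def baseGraph (w : Sym2 V → ℝ) : WGraph V where
  nodes := Finset.univ
  weight := w
  size _ := 1

end Leiden

end

noncomputable section

namespace Leiden

universe u

/-! ### Partitions -/

/-! Write `excess A B = E(A,B) - γ‖A‖‖B‖`. It is additive over disjoint unions, and moving `S` from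
`C` to `D ≠ C` gains `excess S D - excess S (C \ S)` (`gain_eq`). With `D = ∅`, this says that `A ⊆
C` is well connected exactly when splitting it off gains nothing. Gains are unchanged by aggregation
(`Represents.gain_flatten`).

A partition that is not subset optimal is left with positive probability. Choose an
inclusion-minimal `S` that can be moved with a gain. Minimality makes every nonempty proper subset
`A` of `S` well connected and forces `excess A (S \ A) ≥ 0`, so some node of `S \ A` can be merged
with `A`. Refinement can therefore build `S` one node at a time, leaving all other nodes alone,
because every allowed merge has positive probability (`growable_of_minimal`,
`Growable.mem_support_refinePartition`). In the next round `S` is a single node with an improving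
move. Local moving then raises the quality strictly, and no later step lowers it, so the old
partition cannot be returned.

A subset optimal partition is returned with probability one. Local moving does nothing, and
refinement and aggregation do not change the flattened partition, so only termination is at stake.
While some community has several nodes, that whole community can be built by refinement, so the
graph shrinks with positive probability. If refinement leaves only singletons, the round is in
essence repeated. This gives `m = p + q * m` with `p + q = 1` and `p ≠ 0`, hence `m = 1`, by
induction on the number of nodes (`ValidState.leidenMass_eq_one`).

For the iterated chain, a state with holding probability below one is almost surely not kept forever
(`chainLaw_leave`). There are finitely many states and countably many times, so the exceptional null
sets can be united. -/

/-- `P` is a partition of `N` into nonempty sets. -/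
structure IsPart {α : Type*} (N : Finset α) (P : Finset (Finset α)) : Prop where
  nonempty : ∀ C ∈ P, C.Nonempty
  subset : ∀ C ∈ P, C ⊆ N
  cover : ∀ v ∈ N, ∃ C ∈ P, v ∈ C
  eq_of_mem : ∀ C ∈ P, ∀ D ∈ P, ∀ v, v ∈ C → v ∈ D → C = D

section Partition

variable {α : Type u} {N : Finset α} {P : Finset (Finset α)} {C D S : Finset α}

theorem IsPart.disjoint (h : IsPart N P) (hC : C ∈ P) (hD : D ∈ P) (hne : C ≠ D) :
    Disjoint C D :=
  Finset.disjoint_left.2 fun v hv hv' => hne (h.eq_of_mem C hC D hD v hv hv')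

theorem IsPart.empty_notMem (h : IsPart N P) : ∅ ∉ P := fun h0 => by simpa using h.nonempty _ h0

variable [DecidableEq α]

theorem IsPart.disjoint_of_subset (h : IsPart N P) (hC : C ∈ P) (hS : S ⊆ C)
    (hD : D ∈ insert ∅ P) (hne : D ≠ C) : Disjoint D S := by
  rcases Finset.mem_insert.1 hD with rfl | hD
  · simp
  · exact (h.disjoint hD hC hne).mono_right hS

theorem mem_move {S D X : Finset α} :
    X ∈ move P S D ↔ X ≠ ∅ ∧ (X = D ∪ S ∨ ∃ C ∈ P, C ≠ D ∧ C \ S = X) := by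
  simp only [move, Finset.mem_erase, Finset.mem_insert, Finset.mem_image]
  grind

theorem IsPart.move_self (h : IsPart N P) (hC : C ∈ P) (hS : S ⊆ C) : move P S C = P := by
  have h0 := h.empty_notMem
  have hd : ∀ X ∈ P, X ≠ C → X \ S = X := fun X hX hne =>
    sdiff_eq_left.2 ((h.disjoint hX hC hne).mono_right hS)
  have hu : C ∪ S = C := Finset.union_eq_left.2 hS
  ext X
  rw [mem_move, hu]
  constructor
  · rintro ⟨-, rfl | ⟨Y, hY, hne, rfl⟩⟩
    · exact hC
    · rwa [hd Y hY hne]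
  · intro hX
    refine ⟨fun h' => h0 (h' ▸ hX), ?_⟩
    by_cases hXC : X = C
    · exact Or.inl hXC
    · exact Or.inr ⟨X, hX, hXC, hd X hX hXC⟩

theorem IsPart.move_empty (h : IsPart N P) (D : Finset α) (hD : D ∈ insert ∅ P) :
    move P ∅ D = P := by
  have h0 := h.empty_notMem
  ext X
  rw [mem_move]
  simp only [Finset.union_empty, Finset.sdiff_empty]
  rcases Finset.mem_insert.1 hD with rfl | hD <;> grind

/-- The moved partition, written out. -/
theorem IsPart.move_eq (h : IsPart N P) (hC : C ∈ P) (hS : S ⊆ C) (hne : D ≠ C) :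
    move P S D = (insert (D ∪ S) (insert (C \ S) ((P.erase D).erase C))).erase ∅ := by
  have hd : ∀ X ∈ P, X ≠ C → X \ S = X := fun X hX hne =>
    sdiff_eq_left.2 ((h.disjoint hX hC hne).mono_right hS)
  ext X
  rw [mem_move]
  simp only [Finset.mem_erase, Finset.mem_insert]
  constructor
  · rintro ⟨hX, rfl | ⟨Y, hY, hYD, rfl⟩⟩
    · exact ⟨hX, Or.inl rfl⟩
    · by_cases hYC : Y = C
      · subst hYC
        exact ⟨hX, Or.inr (Or.inl rfl)⟩
      · rw [hd Y hY hYC] at hX ⊢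
        exact ⟨hX, Or.inr (Or.inr ⟨hYC, hYD, hY⟩)⟩
  · rintro ⟨hX, rfl | rfl | ⟨hXC, hXD, hXP⟩⟩
    · exact ⟨hX, Or.inl rfl⟩
    · exact ⟨hX, Or.inr ⟨C, hC, hne.symm, rfl⟩⟩
    · exact ⟨hX, Or.inr ⟨X, hXP, hXD, hd X hXP hXC⟩⟩

theorem IsPart.move (h : IsPart N P) (hC : C ∈ P) (hS : S ⊆ C) (hD : D ∈ insert ∅ P) :
    IsPart N (move P S D) := by
  have hSN := hS.trans (h.subset C hC)
  have hDN : D ⊆ N := by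
    rcases Finset.mem_insert.1 hD with rfl | hD
    · simp
    · exact h.subset D hD
  have hDP : ∀ Y ∈ P, ∀ v ∈ Y, v ∈ D → Y = D := by
    intro Y hY v hv hvD
    rcases Finset.mem_insert.1 hD with rfl | hD
    · simp at hvD
    · exact h.eq_of_mem _ hY _ hD v hv hvD
  constructor
  · intro X hX
    exact Finset.nonempty_iff_ne_empty.2 (mem_move.1 hX).1
  · intro X hX
    rcases (mem_move.1 hX).2 with rfl | ⟨Y, hY, -, rfl⟩
    · exact Finset.union_subset hDN hSN
    · exact Finset.sdiff_subset.trans (h.subset Y hY)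
  · intro v hv
    by_cases hvS : v ∈ D ∪ S
    · exact ⟨D ∪ S, mem_move.2 ⟨Finset.ne_empty_of_mem hvS, Or.inl rfl⟩, hvS⟩
    · obtain ⟨Y, hY, hvY⟩ := h.cover v hv
      have hv' : v ∈ Y \ S := by grind
      exact ⟨Y \ S, mem_move.2 ⟨Finset.ne_empty_of_mem hv', Or.inr ⟨Y, hY, by grind, rfl⟩⟩, hv'⟩
  · intro X hX Y hY v hvX hvY
    rcases (mem_move.1 hX).2 with rfl | ⟨X', hX', hXD, rfl⟩ <;>
    rcases (mem_move.1 hY).2 with rfl | ⟨Y', hY', hYD, rfl⟩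
    · rfl
    · rw [Finset.mem_sdiff] at hvY
      exact absurd (hDP Y' hY' v hvY.1 (by grind)) hYD
    · rw [Finset.mem_sdiff] at hvX
      exact absurd (hDP X' hX' v hvX.1 (by grind)) hXD
    · rw [Finset.mem_sdiff] at hvX hvY
      rw [h.eq_of_mem X' hX' Y' hY' v hvX.1 hvY.1]

theorem IsPart.sum_card (h : IsPart N P) : ∑ C ∈ P, #C = #N := by
  rw [← Finset.card_biUnion fun C hC D hD hne => h.disjoint hC hD hne]
  congr 1
  ext v
  rw [Finset.mem_biUnion]
  exact ⟨fun ⟨C, hC, hv⟩ => h.subset C hC hv, h.cover v⟩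

theorem IsPart.card_le (h : IsPart N P) : #P ≤ #N := by
  rw [← h.sum_card, Finset.card_eq_sum_ones]
  exact Finset.sum_le_sum fun C hC => Finset.card_pos.2 (h.nonempty C hC)

theorem IsPart.card_eq_one (h : IsPart N P) (hc : #N ≤ #P) (hC : C ∈ P) : #C = 1 := by
  have h1 : ∀ C ∈ P, 1 ≤ #C := fun C hC => Finset.card_pos.2 (h.nonempty C hC)
  have h2 : ∑ C ∈ P, 1 = ∑ C ∈ P, #C := by
    rw [h.sum_card, ← Finset.card_eq_sum_ones]
    exact le_antisymm h.card_le hc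
  exact ((Finset.sum_eq_sum_iff_of_le h1).1 h2 C hC).symm

theorem IsPart.eq_singletons (h : IsPart N P) (hc : #N ≤ #P) : P = N.image fun v => {v} := by
  ext X
  rw [Finset.mem_image]
  constructor
  · intro hX
    obtain ⟨v, rfl⟩ := Finset.card_eq_one.1 (h.card_eq_one hc hX)
    exact ⟨v, h.subset _ hX (Finset.mem_singleton_self v), rfl⟩
  · rintro ⟨v, hv, rfl⟩
    obtain ⟨X, hX, hvX⟩ := h.cover v hv
    obtain ⟨w, rfl⟩ := Finset.card_eq_one.1 (h.card_eq_one hc hX)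
    rwa [← Finset.mem_singleton.1 hvX] at hX

theorem isPart_singletons (N : Finset α) : IsPart N (N.image fun v => {v}) := by
  constructor <;> simp

theorem IsPart.exists_one_lt_card (h : IsPart N P) (hc : #P < #N) : ∃ C ∈ P, 1 < #C := by
  by_contra! hcon
  have := Finset.sum_le_sum hcon
  rw [h.sum_card, ← Finset.card_eq_sum_ones] at this
  omega

end Partition

/-! ### Weights between sets and the gain of a move -/

section Weights

variable {α : Type u} {G : WGraph α} {γ : ℝ} {A B C D S : Finset α}
  {P : Finset (Finset α)}

@[simp] theorem setSize_empty : setSize G ∅ = 0 := by simp [setSize]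

variable [DecidableEq α]

theorem setSize_union (h : Disjoint A B) : setSize G (A ∪ B) = setSize G A + setSize G B :=
  Finset.sum_union h

theorem edgeWeight_union_self (h : Disjoint A B) :
    edgeWeight G (A ∪ B) (A ∪ B) = edgeWeight G A A + edgeWeight G B B + edgeWeight G A B := by
  unfold edgeWeight
  rw [Finset.disjoint_left] at h
  rw [← Finset.sum_union, ← Finset.sum_union]
  · congr 1
    ext e
    simp only [Finset.mem_filter, Finset.mem_union]
    constructor
    · rintro ⟨he, u, hu | hu, v, hv | hv, rfl⟩
      · exact Or.inl (Or.inl ⟨he, u, hu, v, hv, rfl⟩)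
      · exact Or.inr ⟨he, u, hu, v, hv, rfl⟩
      · exact Or.inr ⟨he, v, hv, u, hu, Sym2.eq_swap⟩
      · exact Or.inl (Or.inr ⟨he, u, hu, v, hv, rfl⟩)
    · rintro ((⟨he, u, hu, v, hv, rfl⟩ | ⟨he, u, hu, v, hv, rfl⟩) | ⟨he, u, hu, v, hv, rfl⟩)
      exacts [⟨he, u, Or.inl hu, v, Or.inl hv, rfl⟩, ⟨he, u, Or.inr hu, v, Or.inr hv, rfl⟩,
        ⟨he, u, Or.inl hu, v, Or.inr hv, rfl⟩]
  · rw [Finset.disjoint_left]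
    simp only [Finset.mem_filter, Finset.mem_union]
    rintro e (⟨-, u, hu, v, hv, rfl⟩ | ⟨-, u, hu, v, hv, rfl⟩) ⟨-, u', hu', v', hv', h'⟩ <;>
      rcases Sym2.eq_iff.1 h' with ⟨rfl, rfl⟩ | ⟨rfl, rfl⟩ <;> grind
  · rw [Finset.disjoint_left]
    simp only [Finset.mem_filter]
    rintro e ⟨-, u, hu, v, hv, rfl⟩ ⟨-, u', hu', v', hv', h'⟩
    rcases Sym2.eq_iff.1 h' with ⟨rfl, rfl⟩ | ⟨rfl, rfl⟩ <;> grind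

/-- An edge is counted once, so a double count would need an edge read from `A` to `B` one way and
from `A` to `C` the other way. Its end in `B` would then lie in `A`. This is why `A` and `C` need
not be disjoint. -/
theorem edgeWeight_union_right (hB : Disjoint A B) (hBC : Disjoint B C) :
    edgeWeight G A (B ∪ C) = edgeWeight G A B + edgeWeight G A C := by
  unfold edgeWeight
  rw [Finset.disjoint_left] at hB hBC
  rw [← Finset.sum_union]
  · congr 1
    ext e
    simp only [Finset.mem_filter, Finset.mem_union]
    constructor
    · rintro ⟨he, u, hu, v, hv | hv, rfl⟩
      · exact Or.inl ⟨he, u, hu, v, hv, rfl⟩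
      · exact Or.inr ⟨he, u, hu, v, hv, rfl⟩
    · rintro (⟨he, u, hu, v, hv, rfl⟩ | ⟨he, u, hu, v, hv, rfl⟩)
      exacts [⟨he, u, hu, v, Or.inl hv, rfl⟩, ⟨he, u, hu, v, Or.inr hv, rfl⟩]
  · rw [Finset.disjoint_left]
    simp only [Finset.mem_filter]
    rintro e ⟨-, u, hu, v, hv, rfl⟩ ⟨-, u', hu', v', hv', h'⟩
    rcases Sym2.eq_iff.1 h' with ⟨rfl, rfl⟩ | ⟨rfl, rfl⟩ <;> grind

@[simp] theorem edgeWeight_empty_right : edgeWeight G A ∅ = 0 := by simp [edgeWeight]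

/-- The quality of a single community. -/
def blockQuality (γ : ℝ) (G : WGraph α) (C : Finset α) : ℝ :=
  edgeWeight G C C - γ * ((setSize G C).choose 2 : ℕ)

/-- The change in quality when two disjoint sets of nodes are merged. -/
def excess (γ : ℝ) (G : WGraph α) (A B : Finset α) : ℝ :=
  edgeWeight G A B - γ * setSize G A * setSize G B

theorem excess_comm : excess γ G A B = excess γ G B A := by
  unfold excess
  rw [edgeWeight_comm]
  ring

theorem excess_union_right (hB : Disjoint A B) (hBC : Disjoint B C) :
    excess γ G A (B ∪ C) = excess γ G A B + excess γ G A C := by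
  unfold excess
  rw [edgeWeight_union_right hB hBC, setSize_union hBC]
  push_cast
  ring

theorem excess_union_left (hB : Disjoint A B) (hBC : Disjoint B C) :
    excess γ G (B ∪ C) A = excess γ G B A + excess γ G C A := by
  rw [excess_comm, excess_union_right hB hBC, excess_comm, excess_comm (A := A)]

@[simp] theorem excess_empty_right : excess γ G A ∅ = 0 := by simp [excess]

/-- The cross term comes from `(a + b).choose 2 = a.choose 2 + b.choose 2 + a * b`. -/
theorem blockQuality_union (h : Disjoint A B) :
    blockQuality γ G (A ∪ B) = blockQuality γ G A + blockQuality γ G B + excess γ G A B := by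
  unfold blockQuality excess
  rw [edgeWeight_union_self h, setSize_union h, Nat.cast_choose_two, Nat.cast_choose_two,
    Nat.cast_choose_two]
  push_cast
  ring

@[simp] theorem blockQuality_empty : blockQuality γ G ∅ = 0 := by simp [blockQuality]

theorem quality_eq_sum : quality γ G P = ∑ C ∈ P, blockQuality γ G C := rfl

theorem wellConnected_iff (h : C ⊆ S) : WellConnected γ G S C ↔ 0 ≤ excess γ G C (S \ C) := by
  unfold WellConnected excess
  have : (setSize G S : ℝ) = setSize G (S \ C) + setSize G C := by
    rw [← Nat.cast_add, ← setSize_union Finset.sdiff_disjoint, Finset.sdiff_union_of_subset h]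
  rw [this, sub_nonneg, add_sub_cancel_right]

variable {N : Finset α}

theorem gain_self (h : IsPart N P) (hC : C ∈ P) (hS : S ⊆ C) : gain γ G P S C = 0 := by
  rw [gain, h.move_self hC hS, sub_self]

theorem gain_empty (h : IsPart N P) (hD : D ∈ insert ∅ P) : gain γ G P ∅ D = 0 := by
  rw [gain, h.move_empty D hD, sub_self]

/-- Cutting `S` off from `C` loses `excess S (C \ S)`, joining it to `D` adds `excess S D`, and all
other blocks cancel. Empty blocks have quality zero, so a new community and a vacated one need no
separate treatment. -/
theorem gain_eq (h : IsPart N P) (hC : C ∈ P) (hS : S ⊆ C) (hD : D ∈ insert ∅ P) (hne : D ≠ C) :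
    gain γ G P S D = excess γ G S D - excess γ G S (C \ S) := by
  have hdisj := h.disjoint_of_subset hC hS hD hne
  have hCq : blockQuality γ G C
      = blockQuality γ G S + blockQuality γ G (C \ S) + excess γ G S (C \ S) := by
    rw [← blockQuality_union Finset.disjoint_sdiff, Finset.union_sdiff_of_subset hS]
  rcases S.eq_empty_or_nonempty with rfl | ⟨s, hs⟩
  · rw [gain_empty h hD, excess_comm, excess_comm (A := ∅)]
    simp
  have h1 : D ∪ S ∉ insert (C \ S) ((P.erase D).erase C) := by
    simp only [Finset.mem_insert, Finset.mem_erase, not_or, not_and]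
    refine ⟨fun h' => ?_, fun hne' _ hmem =>
      hne' (h.eq_of_mem _ hmem _ hC s (by simp [hs]) (hS hs))⟩
    have : s ∈ C \ S := h' ▸ by simp [hs]
    simp [hs] at this
  have h2 : C \ S ∉ (P.erase D).erase C := by
    simp only [Finset.mem_erase, not_and]
    intro hne' _ hmem
    obtain ⟨x, hx⟩ := h.nonempty _ hmem
    exact hne' (h.eq_of_mem _ hmem _ hC x hx (Finset.sdiff_subset hx))
  rw [gain, h.move_eq hC hS hne, quality_eq_sum, quality_eq_sum,
    Finset.sum_erase _ blockQuality_empty, Finset.sum_insert h1, Finset.sum_insert h2]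
  have h3 : ∑ X ∈ P, blockQuality γ G X = blockQuality γ G C + blockQuality γ G D
      + ∑ X ∈ (P.erase D).erase C, blockQuality γ G X := by
    rcases Finset.mem_insert.1 hD with rfl | hD
    · rw [Finset.erase_eq_of_notMem h.empty_notMem, ← Finset.add_sum_erase _ _ hC]
      simp
    · rw [← Finset.add_sum_erase _ _ hD, ← Finset.add_sum_erase (P.erase D) _
        (Finset.mem_erase.2 ⟨hne.symm, hC⟩)]
      ring
  rw [h3, hCq, blockQuality_union hdisj, excess_comm (A := D)]
  ring

end Weights

/-! ### Flattening -/

section Flatten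

variable {V : Type u} [DecidableEq V] {M : Finset V} {N C D S : Finset (Finset V)}

theorem mem_flatten {v : V} : v ∈ flatten C ↔ ∃ A ∈ C, v ∈ A := by simp [flatten]

@[simp] theorem flatten_empty : flatten (∅ : Finset (Finset V)) = ∅ := by simp [flatten]

@[simp] theorem flatten_singleton (A : Finset V) : flatten {A} = A := by simp [flatten]

theorem flatten_mono (h : C ⊆ D) : flatten C ⊆ flatten D :=
  Finset.biUnion_subset_biUnion_of_subset_left _ h

theorem flatten_image_singleton (A : Finset V) : flatten (A.image fun v => {v}) = A := by
  ext v
  simp [mem_flatten]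

theorem IsPart.mem_of_mem_flatten (h : IsPart M N) (hC : C ⊆ N) {A : Finset V} (hA : A ∈ N) {v : V}
    (hv : v ∈ A) (hvC : v ∈ flatten C) : A ∈ C := by
  obtain ⟨A', hA', hv'⟩ := mem_flatten.1 hvC
  rwa [h.eq_of_mem A hA A' (hC hA') v hv hv']

theorem IsPart.subset_of_flatten_subset (h : IsPart M N) (hC : C ⊆ N) (hD : D ⊆ N)
    (hsub : flatten C ⊆ flatten D) : C ⊆ D := by
  intro A hA
  obtain ⟨v, hv⟩ := h.nonempty A (hC hA)
  exact h.mem_of_mem_flatten hD (hC hA) hv (hsub (mem_flatten.2 ⟨A, hA, hv⟩))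

theorem IsPart.flatten_inj (h : IsPart M N) (hC : C ⊆ N) (hD : D ⊆ N)
    (heq : flatten C = flatten D) : C = D :=
  (h.subset_of_flatten_subset hC hD heq.subset).antisymm
    (h.subset_of_flatten_subset hD hC heq.symm.subset)

theorem IsPart.flatten_sdiff (h : IsPart M N) (hC : C ⊆ N) (hS : S ⊆ N) :
    flatten (C \ S) = flatten C \ flatten S := by
  ext v
  simp only [mem_flatten, Finset.mem_sdiff]
  constructor
  · rintro ⟨A, ⟨hA, hAS⟩, hv⟩
    exact ⟨⟨A, hA, hv⟩, fun ⟨A', hA', hv'⟩ =>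
      hAS (h.eq_of_mem A (hC hA) A' (hS hA') v hv hv' ▸ hA')⟩
  · rintro ⟨⟨A, hA, hv⟩, hn⟩
    exact ⟨A, ⟨hA, fun hAS => hn ⟨A, hAS, hv⟩⟩, hv⟩

theorem IsPart.image_flatten {P : Finset (Finset (Finset V))} (h : IsPart M N) (hP : IsPart N P) :
    IsPart M (P.image flatten) := by
  constructor
  · simp only [Finset.mem_image]
    rintro _ ⟨C, hC, rfl⟩
    obtain ⟨A, hA⟩ := hP.nonempty C hC
    obtain ⟨v, hv⟩ := h.nonempty A (hP.subset C hC hA)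
    exact ⟨v, mem_flatten.2 ⟨A, hA, hv⟩⟩
  · simp only [Finset.mem_image]
    rintro _ ⟨C, hC, rfl⟩ v hv
    obtain ⟨A, hA, hv⟩ := mem_flatten.1 hv
    exact h.subset A (hP.subset C hC hA) hv
  · intro v hv
    obtain ⟨A, hA, hvA⟩ := h.cover v hv
    obtain ⟨C, hC, hAC⟩ := hP.cover A hA
    exact ⟨flatten C, Finset.mem_image_of_mem _ hC, mem_flatten.2 ⟨A, hAC, hvA⟩⟩
  · simp only [Finset.mem_image]
    rintro _ ⟨C, hC, rfl⟩ _ ⟨D, hD, rfl⟩ v hvC hvD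
    obtain ⟨A, hA, hvA⟩ := mem_flatten.1 hvC
    rw [hP.eq_of_mem C hC D hD A hA
      (h.mem_of_mem_flatten (hP.subset D hD) (hP.subset C hC hA) hvA hvD)]

theorem card_image_flatten {P : Finset (Finset (Finset V))} (h : IsPart M N) (hP : IsPart N P) :
    #(P.image flatten) = #P :=
  Finset.card_image_of_injOn fun C hC D hD heq =>
    h.flatten_inj (hP.subset C hC) (hP.subset D hD) heq

end Flatten

/-! ### Aggregate graphs as quotients of the base graph -/

section Represents

variable {V : Type u} [DecidableEq V] {B : WGraph V} {G : WGraph (Finset V)} {γ : ℝ}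
  {C D S A : Finset (Finset V)} {P R : Finset (Finset (Finset V))}

/-- `G` arises from `B` by aggregating the parts of a partition. -/
structure Represents (B : WGraph V) (G : WGraph (Finset V)) : Prop where
  isPart : IsPart B.nodes G.nodes
  weight_eq : ∀ X ∈ G.nodes, ∀ Y ∈ G.nodes, G.weight s(X, Y) = edgeWeight B X Y
  size_eq : ∀ X ∈ G.nodes, G.size X = setSize B X

theorem Represents.setSize_flatten (h : Represents B G) (hC : C ⊆ G.nodes) :
    setSize G C = setSize B (flatten C) := by
  unfold setSize flatten
  rw [Finset.sum_biUnion (t := id) fun X hX Y hY hne => h.isPart.disjoint (hC hX) (hC hY) hne]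
  exact Finset.sum_congr rfl fun X hX => h.size_eq X (hC hX)

open scoped Classical in
-- Each aggregate edge, loops included, stands for the set `piece` of base edges running between its
-- two nodes. The sum over aggregate edges becomes a sum over the disjoint union of these pieces.
theorem Represents.edgeWeight_flatten (h : Represents B G) (hC : C ⊆ G.nodes) (hD : D ⊆ G.nodes) :
    edgeWeight G C D = edgeWeight B (flatten C) (flatten D) := by
  let piece : Sym2 (Finset V) → Finset (Sym2 V) := fun e' =>
    {e ∈ B.nodes.sym2 | ∃ X Y, e' = s(X, Y) ∧ ∃ u ∈ X, ∃ v ∈ Y, e = s(u, v)}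
  have hpiece : ∀ e' ∈ G.nodes.sym2, G.weight e' = ∑ e ∈ piece e', B.weight e := by
    intro e'
    induction e' using Sym2.ind with
    | _ X Y =>
      intro he
      rw [Finset.mk_mem_sym2_iff] at he
      rw [h.weight_eq X he.1 Y he.2]
      refine Finset.sum_congr (Finset.filter_congr fun e _ => ?_) fun _ _ => rfl
      constructor
      · exact fun hex => ⟨X, Y, rfl, hex⟩
      · rintro ⟨X', Y', heq, u, hu, v, hv, rfl⟩
        rcases Sym2.eq_iff.1 heq with ⟨rfl, rfl⟩ | ⟨rfl, rfl⟩
        · exact ⟨u, hu, v, hv, rfl⟩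
        · exact ⟨v, hv, u, hu, Sym2.eq_swap⟩
  rw [edgeWeight, Finset.sum_congr rfl fun e' he' => hpiece e' (Finset.mem_filter.1 he').1,
    ← Finset.sum_biUnion]
  · refine Finset.sum_congr ?_ fun _ _ => rfl
    ext e
    simp only [Finset.mem_biUnion, Finset.mem_filter, piece, mem_flatten]
    constructor
    · rintro ⟨_, ⟨he', X, hX, Y, hY, rfl⟩, he, X', Y', heq, u, hu, v, hv, rfl⟩
      rcases Sym2.eq_iff.1 heq with ⟨rfl, rfl⟩ | ⟨rfl, rfl⟩
      · exact ⟨he, u, ⟨X, hX, hu⟩, v, ⟨Y, hY, hv⟩, rfl⟩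
      · exact ⟨he, v, ⟨X, hX, hv⟩, u, ⟨Y, hY, hu⟩, Sym2.eq_swap⟩
    · rintro ⟨he, u, ⟨X, hX, hu⟩, v, ⟨Y, hY, hv⟩, rfl⟩
      exact ⟨s(X, Y), ⟨Finset.mk_mem_sym2_iff.2 ⟨hC hX, hD hY⟩, X, hX, Y, hY, rfl⟩, he, X, Y, rfl,
        u, hu, v, hv, rfl⟩
  -- The nodes are disjoint sets, so the two ends of a base edge determine the aggregate edge to
  -- which it belongs.
  · intro e₁ he₁ e₂ he₂ hne
    refine Finset.disjoint_left.2 fun e h₁ h₂ => hne ?_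
    simp only [Finset.mem_filter, piece] at h₁ h₂
    obtain ⟨-, X, Y, rfl, u, hu, v, hv, rfl⟩ := h₁
    obtain ⟨-, X', Y', rfl, u', hu', v', hv', heq⟩ := h₂
    have he₁' := Finset.mk_mem_sym2_iff.1 (Finset.mem_filter.1 he₁).1
    have he₂' := Finset.mk_mem_sym2_iff.1 (Finset.mem_filter.1 he₂).1
    rcases Sym2.eq_iff.1 heq with ⟨rfl, rfl⟩ | ⟨rfl, rfl⟩
    · rw [h.isPart.eq_of_mem X he₁'.1 X' he₂'.1 u hu hu',
        h.isPart.eq_of_mem Y he₁'.2 Y' he₂'.2 v hv hv']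
    · rw [h.isPart.eq_of_mem X he₁'.1 Y' he₂'.2 u hu hv',
        h.isPart.eq_of_mem Y he₁'.2 X' he₂'.1 v hv hu', Sym2.eq_swap]

theorem Represents.excess_flatten (h : Represents B G) (hC : C ⊆ G.nodes) (hD : D ⊆ G.nodes) :
    excess γ G C D = excess γ B (flatten C) (flatten D) := by
  rw [excess, excess, h.edgeWeight_flatten hC hD, h.setSize_flatten hC, h.setSize_flatten hD]

theorem Represents.quality_flatten (h : Represents B G) (hP : IsPart G.nodes P) :
    quality γ G P = quality γ B (P.image flatten) := by
  rw [quality_eq_sum, quality_eq_sum, Finset.sum_image fun C hC D hD heq =>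
    h.isPart.flatten_inj (hP.subset C hC) (hP.subset D hD) heq]
  refine Finset.sum_congr rfl fun C hC => ?_
  have hC := hP.subset C hC
  rw [blockQuality, blockQuality, h.edgeWeight_flatten hC hC, h.setSize_flatten hC]

theorem Represents.gain_flatten (h : Represents B G) (hP : IsPart G.nodes P) (hC : C ∈ P)
    (hS : S ⊆ C) (hD : D ∈ insert ∅ P) :
    gain γ G P S D = gain γ B (P.image flatten) (flatten S) (flatten D) := by
  have hQ := h.isPart.image_flatten hP
  have hCN := hP.subset C hC
  have hDN : D ⊆ G.nodes := by
    rcases Finset.mem_insert.1 hD with rfl | hD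
    · simp
    · exact hP.subset D hD
  by_cases hne : D = C
  · subst hne
    rw [gain_self hP hC hS, gain_self hQ (Finset.mem_image_of_mem _ hC) (flatten_mono hS)]
  · rw [gain_eq hP hC hS hD hne, gain_eq hQ (Finset.mem_image_of_mem _ hC) (flatten_mono hS),
      h.excess_flatten (hS.trans hCN) hDN,
      h.excess_flatten (hS.trans hCN) (Finset.sdiff_subset.trans hCN),
      h.isPart.flatten_sdiff hCN (hS.trans hCN)]
    · rcases Finset.mem_insert.1 hD with rfl | hD
      · simp
      · exact Finset.mem_insert_of_mem (Finset.mem_image_of_mem _ hD)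
    · exact fun heq => hne (h.isPart.flatten_inj hDN hCN heq)

theorem mem_insert_empty_image_flatten (hD : D ∈ insert ∅ P) :
    flatten D ∈ insert ∅ (P.image flatten) := by
  rcases Finset.mem_insert.1 hD with rfl | hD
  · simp
  · exact Finset.mem_insert_of_mem (Finset.mem_image_of_mem _ hD)

theorem exists_flatten_eq {X : Finset V} (hX : X ∈ insert ∅ (P.image flatten)) :
    ∃ D ∈ insert ∅ P, flatten D = X := by
  rcases Finset.mem_insert.1 hX with rfl | hX
  · exact ⟨∅, Finset.mem_insert_self _ _, flatten_empty⟩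
  · obtain ⟨D, hD, rfl⟩ := Finset.mem_image.1 hX
    exact ⟨D, Finset.mem_insert_of_mem hD, rfl⟩

/-- Sets of aggregate nodes flatten to particular subsets of base communities, so there are fewer
moves to test. Optimality thus passes from the base graph to every aggregate. -/
theorem Represents.subsetOptimal (h : Represents B G) (hP : IsPart G.nodes P)
    (hopt : SubsetOptimal γ B (P.image flatten)) : SubsetOptimal γ G P := by
  intro C hC S hS D hD
  rw [h.gain_flatten hP hC hS hD]
  exact hopt _ (Finset.mem_image_of_mem _ hC) _ (flatten_mono hS) _
    (mem_insert_empty_image_flatten hD)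

/-! ### Aggregation -/

theorem members_flatten (h : IsPart B.nodes G.nodes) (hC : C ⊆ G.nodes) :
    members G (flatten C) = C := by
  ext A
  simp only [members, Finset.mem_filter]
  constructor
  · rintro ⟨hA, hsub⟩
    obtain ⟨v, hv⟩ := h.nonempty A hA
    exact h.mem_of_mem_flatten hC hA hv (hsub hv)
  · exact fun hA => ⟨hC hA, fun v hv => mem_flatten.2 ⟨A, hA, hv⟩⟩

theorem Represents.aggregateGraph (h : Represents B G) (hR : IsPart G.nodes R) :
    Represents B (aggregateGraph G R) where
  isPart := h.isPart.image_flatten hR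
  weight_eq := by
    intro X hX Y hY
    obtain ⟨C, hC, rfl⟩ := Finset.mem_image.1 hX
    obtain ⟨D, hD, rfl⟩ := Finset.mem_image.1 hY
    have hC := hR.subset C hC
    have hD := hR.subset D hD
    change edgeWeight G (members G (flatten C)) (members G (flatten D)) = _
    rw [members_flatten h.isPart hC, members_flatten h.isPart hD, h.edgeWeight_flatten hC hD]
  size_eq := by
    intro X hX
    obtain ⟨C, hC, rfl⟩ := Finset.mem_image.1 hX
    have hC := hR.subset C hC
    change setSize G (members G (flatten C)) = _
    rw [members_flatten h.isPart hC, h.setSize_flatten hC]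

theorem represents_liftGraph (B : WGraph V) : Represents B (liftGraph B) :=
  ⟨isPart_singletons _, fun _ _ _ _ => rfl, fun _ _ => rfl⟩

/-- The hypothesis `href` ensures that no node of `G` straddles two blocks of `Q`, so each block is
exactly a union of nodes. -/
theorem flatten_members {Q : Finset (Finset V)} (hG : IsPart B.nodes G.nodes)
    (hQ : IsPart B.nodes Q) (href : ∀ A ∈ G.nodes, ∃ C ∈ Q, A ⊆ C) {C : Finset V} (hC : C ∈ Q) :
    flatten (members G C) = C := by
  ext v
  simp only [mem_flatten, members, Finset.mem_filter]
  constructor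
  · rintro ⟨A, ⟨-, hA⟩, hv⟩
    exact hA hv
  · intro hv
    obtain ⟨A, hA, hvA⟩ := hG.cover v (hQ.subset C hC hv)
    obtain ⟨C', hC', hAC'⟩ := href A hA
    exact ⟨A, ⟨hA, hQ.eq_of_mem C' hC' C hC v (hAC' hvA) hv ▸ hAC'⟩, hvA⟩

theorem isPart_image_members {Q : Finset (Finset V)} (hG : IsPart B.nodes G.nodes)
    (hQ : IsPart B.nodes Q) (href : ∀ A ∈ G.nodes, ∃ C ∈ Q, A ⊆ C) :
    IsPart G.nodes (Q.image (members G)) := by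
  constructor
  · simp only [Finset.mem_image]
    rintro _ ⟨C, hC, rfl⟩
    obtain ⟨v, hv⟩ := hQ.nonempty C hC
    rw [← flatten_members hG hQ href hC] at hv
    obtain ⟨A, hA, -⟩ := mem_flatten.1 hv
    exact ⟨A, hA⟩
  · simp only [Finset.mem_image]
    rintro _ ⟨C, hC, rfl⟩
    exact Finset.filter_subset _ _
  · intro A hA
    obtain ⟨C, hC, hAC⟩ := href A hA
    exact ⟨members G C, Finset.mem_image_of_mem _ hC, Finset.mem_filter.2 ⟨hA, hAC⟩⟩
  · simp only [Finset.mem_image]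
    rintro _ ⟨C, hC, rfl⟩ _ ⟨D, hD, rfl⟩ A hAC hAD
    simp only [members, Finset.mem_filter] at hAC hAD
    obtain ⟨v, hv⟩ := hG.nonempty A hAC.1
    rw [hQ.eq_of_mem C hC D hD v (hAC.2 hv) (hAD.2 hv)]

theorem image_flatten_image_members {Q : Finset (Finset V)} (hG : IsPart B.nodes G.nodes)
    (hQ : IsPart B.nodes Q) (href : ∀ A ∈ G.nodes, ∃ C ∈ Q, A ⊆ C) :
    (Q.image (members G)).image flatten = Q := by
  rw [Finset.image_image]
  ext C
  simp only [Finset.mem_image, Function.comp]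
  constructor
  · rintro ⟨D, hD, rfl⟩
    rwa [flatten_members hG hQ href hD]
  · exact fun hC => ⟨C, hC, flatten_members hG hQ href hC⟩

theorem image_flatten_liftPartition (Q : Finset (Finset V)) :
    (liftPartition Q).image flatten = Q := by
  simp [liftPartition, Finset.image_image, Function.comp_def, flatten_image_singleton]

theorem isPart_liftPartition {Q : Finset (Finset V)} (hQ : IsPart B.nodes Q) :
    IsPart (liftGraph B).nodes (liftPartition Q) := by
  have hnodes : (liftGraph B).nodes = B.nodes.image fun v => {v} := rfl
  constructor
  · simp only [liftPartition, Finset.mem_image]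
    rintro _ ⟨C, hC, rfl⟩
    exact (hQ.nonempty C hC).image _
  · simp only [liftPartition, Finset.mem_image]
    rintro _ ⟨C, hC, rfl⟩
    exact Finset.image_subset_image (hQ.subset C hC)
  · rw [hnodes]
    simp only [liftPartition, Finset.mem_image]
    rintro _ ⟨v, hv, rfl⟩
    obtain ⟨C, hC, hvC⟩ := hQ.cover v hv
    exact ⟨_, ⟨C, hC, rfl⟩, Finset.mem_image_of_mem _ hvC⟩
  · simp only [liftPartition, Finset.mem_image]
    rintro _ ⟨C, hC, rfl⟩ _ ⟨D, hD, rfl⟩ A hAC hAD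
    obtain ⟨v, hv, rfl⟩ := Finset.mem_image.1 hAC
    obtain ⟨w, hw, hwv⟩ := Finset.mem_image.1 hAD
    rw [Finset.singleton_inj] at hwv
    rw [hQ.eq_of_mem C hC D hD v hv (hwv ▸ hw)]

end Represents

/-! ### Local moving -/

section LocalMoving

variable {α : Type u} [DecidableEq α] [Fintype α] {γ : ℝ} {c : Choices γ α} {G : WGraph α}

/-- For the strict inequality: either some move with positive gain happens, or the partition is
still `P` when the improvable node is reached, and then `best` must find a positive gain. -/
theorem moveLoop_support : ∀ (P : Finset (Finset α)) (Q : List α), IsPart G.nodes P →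
    (∀ v ∈ Q, v ∈ G.nodes) → ∀ P' ∈ (moveLoop γ c G P Q).support,
      IsPart G.nodes P' ∧ quality γ G P ≤ quality γ G P' ∧
        ((∃ v ∈ Q, ∃ D ∈ insert ∅ P, 0 < gain γ G P {v} D) → quality γ G P < quality γ G P')
  | P, [], hP, _, P', hP' => by
    rw [moveLoop, PMF.mem_support_pure_iff] at hP'
    subst hP'
    exact ⟨hP, le_rfl, by simp⟩
  | P, v :: Q, hP, hQ, P', hP' => by
    rw [moveLoop, PMF.mem_support_bind_iff] at hP'
    obtain ⟨C, hC, hP'⟩ := hP'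
    split_ifs at hP' with hgain
    · rw [PMF.mem_support_bind_iff] at hP'
      obtain ⟨L, hL, hP'⟩ := hP'
      obtain ⟨C₀, hC₀, hv⟩ := hP.cover v (hQ v (by simp))
      have hQL : ∀ u ∈ Q ++ L, u ∈ G.nodes := by
        intro u hu
        rcases List.mem_append.1 hu with hu | hu
        · exact hQ u (by simp [hu])
        · rw [← List.mem_toFinset, (c.order_spec _ L hL).2] at hu
          exact (Finset.mem_filter.1 (Finset.sdiff_subset hu)).1
      obtain ⟨h1, h2, -⟩ := moveLoop_support (Leiden.move P {v} C) (Q ++ L)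
        (hP.move hC₀ (by simpa using hv) (c.best_mem _ _ _ C hC)) hQL P' hP'
      have h3 : quality γ G P < quality γ G P' := by
        unfold gain at hgain
        linarith
      exact ⟨h1, h3.le, fun _ => h3⟩
    · obtain ⟨h1, h2, h3⟩ := moveLoop_support P Q hP (fun u hu => hQ u (by simp [hu])) P' hP'
      refine ⟨h1, h2, ?_⟩
      rintro ⟨u, hu, D, hD, hpos⟩
      rcases List.mem_cons.1 hu with rfl | hu
      · exact absurd (hpos.trans_le (c.best_max _ _ _ C hC D hD)) hgain
      · exact h3 ⟨u, hu, D, hD, hpos⟩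
termination_by P Q => (numBetter γ G P, Q.length)
decreasing_by
  · exact Prod.Lex.left _ _ (numBetter_move_lt hgain)
  · exact Prod.Lex.right _ (by simp)

theorem moveLoop_eq_pure {P : Finset (Finset α)}
    (hopt : ∀ v ∈ G.nodes, ∀ D ∈ insert ∅ P, gain γ G P {v} D ≤ 0) :
    ∀ Q : List α, (∀ v ∈ Q, v ∈ G.nodes) → moveLoop γ c G P Q = PMF.pure P
  | [], _ => by rw [moveLoop]
  | v :: Q, hQ => by
    -- Writing the right side as a constant bind reduces the equality to the choices in the support.
    rw [moveLoop, ← PMF.bind_const (c.best G P v) (PMF.pure P)]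
    ext X
    rw [PMF.bind_apply, PMF.bind_apply]
    refine tsum_congr fun C => ?_
    by_cases hC : C ∈ (c.best G P v).support
    · rw [dif_neg (not_lt.2 (hopt v (hQ v (by simp)) C (c.best_mem _ _ _ C hC))),
        moveLoop_eq_pure hopt Q fun u hu => hQ u (by simp [hu])]
    · rw [PMF.mem_support_iff, not_not] at hC
      simp [hC]

theorem mem_support_uniformOrder {ι : Type*} [DecidableEq ι] {s : Finset ι} {L : List ι} :
    L ∈ (uniformOrder s).support ↔ L.Nodup ∧ L.toFinset = s := by
  refine (PMF.mem_support_uniformOfFinset_iff _ L).trans ?_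
  rw [List.mem_toFinset, List.mem_permutations]
  constructor
  · intro h
    exact ⟨h.nodup_iff.2 s.nodup_toList, by rw [List.toFinset_eq_of_perm _ _ h, s.toList_toFinset]⟩
  · rintro ⟨h, rfl⟩
    exact (List.perm_of_nodup_nodup_toFinset_eq h (Finset.nodup_toList _) (by simp))

theorem mem_of_mem_uniformOrder {ι : Type*} [DecidableEq ι] {s : Finset ι} {L : List ι}
    (hL : L ∈ (uniformOrder s).support) {v : ι} : v ∈ L ↔ v ∈ s := by
  rw [← List.mem_toFinset, (mem_support_uniformOrder.1 hL).2]

theorem moveNodesFast_support {P P' : Finset (Finset α)} (hP : IsPart G.nodes P)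
    (hP' : P' ∈ (moveNodesFast γ c G P).support) :
    IsPart G.nodes P' ∧ quality γ G P ≤ quality γ G P' ∧
      ((∃ v ∈ G.nodes, ∃ D ∈ insert ∅ P, 0 < gain γ G P {v} D) →
        quality γ G P < quality γ G P') := by
  rw [moveNodesFast, PMF.mem_support_bind_iff] at hP'
  obtain ⟨Q, hQ, hP'⟩ := hP'
  obtain ⟨h1, h2, h3⟩ := moveLoop_support P Q hP
    (fun v hv => (mem_of_mem_uniformOrder hQ).1 hv) P' hP'
  exact ⟨h1, h2, fun ⟨v, hv, hD⟩ => h3 ⟨v, (mem_of_mem_uniformOrder hQ).2 hv, hD⟩⟩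

theorem moveNodesFast_eq_pure {P : Finset (Finset α)}
    (hopt : ∀ v ∈ G.nodes, ∀ D ∈ insert ∅ P, gain γ G P {v} D ≤ 0) :
    moveNodesFast γ c G P = PMF.pure P := by
  rw [moveNodesFast, ← PMF.bind_const (uniformOrder G.nodes) (PMF.pure P)]
  ext X
  rw [PMF.bind_apply, PMF.bind_apply]
  refine tsum_congr fun Q => ?_
  by_cases hQ : Q ∈ (uniformOrder G.nodes).support
  · rw [moveLoop_eq_pure hopt Q fun v hv => (mem_of_mem_uniformOrder hQ).1 hv]
  · rw [PMF.mem_support_iff, not_not] at hQ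
    simp [hQ]

end LocalMoving

/-! ### Monadic folds of random steps -/

section Fold

variable {β : Type u} {ι : Type*} {f : β → ι → PMF β}

theorem mem_support_foldlM_cons {b b' : β} {i : ι} {L : List ι} :
    b' ∈ ((i :: L).foldlM f b).support ↔ ∃ x ∈ (f b i).support, b' ∈ (L.foldlM f x).support := by
  rw [List.foldlM_cons]
  exact PMF.mem_support_bind_iff _ _ _

theorem mem_support_foldlM_nil {b b' : β} : b' ∈ (([] : List ι).foldlM f b).support ↔ b' = b := by
  rw [List.foldlM_nil]
  exact PMF.mem_support_pure_iff _ _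

theorem foldlM_invariant {p : β → Prop} {L : List ι}
    (hf : ∀ i ∈ L, ∀ b, p b → ∀ b' ∈ (f b i).support, p b') {b b' : β} (hb : p b)
    (hb' : b' ∈ (L.foldlM f b).support) : p b' := by
  induction L generalizing b with
  | nil =>
    rw [mem_support_foldlM_nil] at hb'
    rwa [hb']
  | cons i L ih =>
    obtain ⟨x, hx, hb'⟩ := mem_support_foldlM_cons.1 hb'
    exact ih (fun j hj => hf j (by simp [hj])) (hf i (by simp) b hb x hx) hb'

theorem mem_support_foldlM_append {L₁ L₂ : List ι} {b b' b'' : β}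
    (h₁ : b' ∈ (L₁.foldlM f b).support) (h₂ : b'' ∈ (L₂.foldlM f b').support) :
    b'' ∈ ((L₁ ++ L₂).foldlM f b).support := by
  induction L₁ generalizing b with
  | nil =>
    rw [mem_support_foldlM_nil] at h₁
    rwa [List.nil_append, ← h₁]
  | cons i L ih =>
    obtain ⟨x, hx, h₁⟩ := mem_support_foldlM_cons.1 h₁
    exact mem_support_foldlM_cons.2 ⟨x, hx, ih h₁⟩

theorem mem_support_foldlM_self {L : List ι} {b : β} (h : ∀ i ∈ L, b ∈ (f b i).support) :
    b ∈ (L.foldlM f b).support := by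
  induction L with
  | nil => exact mem_support_foldlM_nil.2 rfl
  | cons i L ih =>
    exact mem_support_foldlM_cons.2 ⟨b, h i (by simp), ih fun j hj => h j (by simp [hj])⟩

end Fold

/-! ### Refinement -/

section Refinement

variable {α : Type u} [DecidableEq α] {γ θ : ℝ} {G : WGraph α} {P R R' : Finset (Finset α)}
  {A C D S T : Finset α} {N : Finset α} {v : α}

/-- Every block of `R` is contained in a block of `P`. -/
def Refines (R P : Finset (Finset α)) : Prop := ∀ X ∈ R, ∃ C ∈ P, X ⊆ C

theorem mem_mergeTargets : D ∈ mergeTargets γ G S R v ↔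
    D ∈ R ∧ D ⊆ S ∧ WellConnected γ G S D ∧ 0 ≤ gain γ G R {v} D := by
  classical
  simp only [mergeTargets, Finset.mem_filter]

theorem mem_support_mergeNode (hv : {v} ∈ R) (hD : D ∈ mergeTargets γ G S R v) :
    move R {v} D ∈ (mergeNode γ θ G S R v).support := by
  rw [mergeNode, if_pos hv, dif_pos ⟨D, hD⟩, PMF.mem_support_bind_iff]
  refine ⟨D, ?_, by simp⟩
  rw [PMF.mem_support_normalize_iff, mergeWeight, if_pos hD]
  simp [Real.exp_pos]

theorem mergeNode_support (hR' : R' ∈ (mergeNode γ θ G S R v).support) :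
    R' = R ∨ {v} ∈ R ∧ ∃ D ∈ R, D ⊆ S ∧ R' = move R {v} D := by
  rw [mergeNode] at hR'
  split_ifs at hR' with hv hne
  · rw [PMF.mem_support_bind_iff] at hR'
    obtain ⟨D, hD, hR'⟩ := hR'
    rw [PMF.mem_support_normalize_iff, mergeWeight] at hD
    rw [PMF.mem_support_pure_iff] at hR'
    split_ifs at hD with hmem
    · rw [mem_mergeTargets] at hmem
      exact Or.inr ⟨hv, D, hmem.1, hmem.2.1, hR'⟩
    · exact absurd rfl hD
  · exact Or.inl (by simpa using hR')
  · exact Or.inl (by simpa using hR')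

/-- A well-connected node on its own has its own singleton among the targets, with gain zero. Hence
refinement may always leave such a node where it is. -/
theorem self_mem_support_mergeNode (hR : IsPart N R) (hv : v ∈ S) (hwc : WellConnected γ G S {v}) :
    R ∈ (mergeNode γ θ G S R v).support := by
  by_cases hmem : {v} ∈ R
  · have h : {v} ∈ mergeTargets γ G S R v := by
      rw [mem_mergeTargets]
      exact ⟨hmem, by simpa using hv, hwc, (gain_self hR hmem subset_rfl).ge⟩
    have := mem_support_mergeNode (θ := θ) hmem h
    rwa [hR.move_self hmem subset_rfl] at this
  · rw [mergeNode, if_neg hmem]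
    simp

theorem self_mem_support_mergeNodesSubset (hR : IsPart N R) :
    R ∈ (mergeNodesSubset γ θ G R S).support := by
  classical
  rw [mergeNodesSubset, PMF.mem_support_bind_iff]
  obtain ⟨L, hL⟩ := PMF.support_nonempty _
  refine ⟨L, hL, mem_support_foldlM_self fun v hv => ?_⟩
  have := (mem_of_mem_uniformOrder hL).1 hv
  rw [Finset.mem_filter] at this
  exact self_mem_support_mergeNode hR this.1 this.2

theorem mergeNode_isPart (hS : S ∈ P) (hv : v ∈ S) (hR : IsPart N R ∧ Refines R P)
    (hR' : R' ∈ (mergeNode γ θ G S R v).support) : IsPart N R' ∧ Refines R' P := by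
  rcases mergeNode_support hR' with rfl | ⟨hmem, D, hD, hDS, rfl⟩
  · exact hR
  · refine ⟨hR.1.move hmem subset_rfl (Finset.mem_insert_of_mem hD), fun X hX => ?_⟩
    rcases (mem_move.1 hX).2 with rfl | ⟨Y, hY, -, rfl⟩
    · exact ⟨S, hS, Finset.union_subset hDS (by simpa using hv)⟩
    · obtain ⟨C, hC, hYC⟩ := hR.2 Y hY
      exact ⟨C, hC, Finset.sdiff_subset.trans hYC⟩

theorem refinePartition_support (hP : IsPart G.nodes P)
    (hR : R ∈ (refinePartition γ θ G P).support) : IsPart G.nodes R ∧ Refines R P := by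
  classical
  rw [refinePartition, PMF.mem_support_bind_iff] at hR
  obtain ⟨L, hL, hR⟩ := hR
  refine foldlM_invariant (p := fun R => IsPart G.nodes R ∧ Refines R P) ?_ ?_ hR
  · intro S hS R₁ hR₁ R₂ hR₂
    rw [mergeNodesSubset, PMF.mem_support_bind_iff] at hR₂
    obtain ⟨L', hL', hR₂⟩ := hR₂
    refine foldlM_invariant (p := fun R => IsPart G.nodes R ∧ Refines R P) ?_ hR₁ hR₂
    intro v hv R₃ hR₃ R₄ hR₄
    have hv := (mem_of_mem_uniformOrder hL').1 hv
    rw [Finset.mem_filter] at hv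
    exact mergeNode_isPart ((mem_of_mem_uniformOrder hL).1 hS) hv.1 hR₃ hR₄
  · refine ⟨isPart_singletons _, ?_⟩
    simp only [singletonPartition, Refines, Finset.mem_image]
    rintro _ ⟨v, hv, rfl⟩
    obtain ⟨C, hC, hvC⟩ := hP.cover v hv
    exact ⟨C, hC, by simpa using hvC⟩

/-! ### Sets that the refinement can build -/

/-- The sets that arise inside the community `C` by merging one node at a time, as the refinement
phase does. -/
inductive Growable (γ : ℝ) (G : WGraph α) (C : Finset α) : Finset α → Prop
  | singleton (v : α) (hv : v ∈ C) : Growable γ G C {v}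
  | insert (A : Finset α) (u : α) (hA : Growable γ G C A) (hu : u ∈ C) (huA : u ∉ A)
      (hwu : WellConnected γ G C {u}) (hwA : WellConnected γ G C A)
      (he : 0 ≤ excess γ G A {u}) : Growable γ G C (insert u A)

theorem Growable.nonempty (h : Growable γ G C A) : A.Nonempty := by
  cases h <;> simp

theorem Growable.subset (h : Growable γ G C A) : A ⊆ C := by
  induction h with
  | singleton v hv => simpa using hv
  | insert A u _ hu _ _ _ _ ih => exact Finset.insert_subset hu ih

/-- The partition of `N` into the set `A` and singletons. -/
def blockPartition (N A : Finset α) : Finset (Finset α) := insert A ((N \ A).image fun v => {v})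

theorem mem_blockPartition {X : Finset α} :
    X ∈ blockPartition N A ↔ X = A ∨ ∃ v ∈ N, v ∉ A ∧ {v} = X := by
  simp [blockPartition, and_assoc]

theorem isPart_blockPartition (hA : A.Nonempty) (hAN : A ⊆ N) : IsPart N (blockPartition N A) := by
  constructor
  · intro X hX
    rcases mem_blockPartition.1 hX with rfl | ⟨v, -, -, rfl⟩
    exacts [hA, Finset.singleton_nonempty v]
  · intro X hX
    rcases mem_blockPartition.1 hX with rfl | ⟨v, hv, -, rfl⟩
    exacts [hAN, by simpa using hv]
  · intro v hv
    by_cases hvA : v ∈ A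
    · exact ⟨A, mem_blockPartition.2 (Or.inl rfl), hvA⟩
    · exact ⟨{v}, mem_blockPartition.2 (Or.inr ⟨v, hv, hvA, rfl⟩), by simp⟩
  · intro X hX Y hY v hvX hvY
    rcases mem_blockPartition.1 hX with rfl | ⟨x, hx, hxA, rfl⟩ <;>
    rcases mem_blockPartition.1 hY with rfl | ⟨y, hy, hyA, rfl⟩ <;>
    simp_all

theorem blockPartition_singleton (hv : v ∈ N) :
    blockPartition N {v} = N.image fun v => {v} := by
  ext X
  rw [mem_blockPartition, Finset.mem_image]
  constructor
  · rintro (rfl | ⟨w, hw, -, rfl⟩)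
    exacts [⟨v, hv, rfl⟩, ⟨w, hw, rfl⟩]
  · rintro ⟨w, hw, rfl⟩
    by_cases h : w = v
    · exact Or.inl (by rw [h])
    · exact Or.inr ⟨w, hw, by simpa using h, rfl⟩

theorem move_blockPartition (hA : A.Nonempty) (hv : v ∈ N) (hvA : v ∉ A) :
    move (blockPartition N A) {v} A = blockPartition N (insert v A) := by
  ext X
  rw [mem_move, mem_blockPartition, Finset.union_singleton]
  constructor
  · rintro ⟨hX, rfl | ⟨Y, hY, hYA, rfl⟩⟩
    · exact Or.inl rfl
    · rcases mem_blockPartition.1 hY with rfl | ⟨w, hw, hwA, rfl⟩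
      · exact absurd rfl hYA
      · have hwv : w ≠ v := by
          rintro rfl
          simp at hX
        exact Or.inr ⟨w, hw, by simp [hwv, hwA], by
          rw [Finset.sdiff_eq_self_of_disjoint (by simpa using hwv)]⟩
  · rintro (rfl | ⟨w, hw, hwA, rfl⟩)
    · exact ⟨by simp, Or.inl rfl⟩
    · simp only [Finset.mem_insert, not_or] at hwA
      refine ⟨by simp, Or.inr ⟨{w}, mem_blockPartition.2 (Or.inr ⟨w, hw, hwA.2, rfl⟩), ?_, ?_⟩⟩
      · rintro rfl
        simp at hwA
      · rw [Finset.sdiff_eq_self_of_disjoint (by simpa using hwA.1)]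

/-- The nodes are visited in the order in which they join the growing set. The founding node need
not be visited, hence the empty list in the base case. -/
theorem Growable.exists_order (hCN : C ⊆ G.nodes) (h : Growable γ G C A) :
    ∃ L : List α, L.Nodup ∧ (∀ u ∈ L, u ∈ A ∧ WellConnected γ G C {u}) ∧
      blockPartition G.nodes A ∈
        (L.foldlM (mergeNode γ θ G C) (singletonPartition G)).support := by
  induction h with
  | singleton v hv =>
    refine ⟨[], by simp, by simp, ?_⟩
    rw [mem_support_foldlM_nil, blockPartition_singleton (hCN hv), singletonPartition]
  | insert A u hA hu huA hwu hwA he ih =>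
    obtain ⟨L, hL, hLA, hmem⟩ := ih
    refine ⟨L ++ [u], ?_, ?_, mem_support_foldlM_append hmem ?_⟩
    · rw [List.nodup_append]
      refine ⟨hL, by simp, fun a ha b hb => ?_⟩
      rw [List.mem_singleton] at hb
      rintro rfl
      exact huA (hb ▸ (hLA a ha).1)
    · intro w hw
      rcases List.mem_append.1 hw with hw | hw
      · exact ⟨Finset.mem_insert_of_mem (hLA w hw).1, (hLA w hw).2⟩
      · rw [List.mem_singleton] at hw
        subst hw
        exact ⟨Finset.mem_insert_self _ _, hwu⟩
    · rw [mem_support_foldlM_cons]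
      refine ⟨_, ?_, mem_support_foldlM_nil.2 rfl⟩
      have hpart := isPart_blockPartition hA.nonempty (hA.subset.trans hCN)
      have huR : {u} ∈ blockPartition G.nodes A :=
        mem_blockPartition.2 (Or.inr ⟨u, hCN hu, huA, rfl⟩)
      have hAR : A ∈ blockPartition G.nodes A := mem_blockPartition.2 (Or.inl rfl)
      rw [← move_blockPartition hA.nonempty (hCN hu) huA]
      refine mem_support_mergeNode huR (mem_mergeTargets.2 ⟨hAR, hA.subset, hwA, ?_⟩)
      rw [gain_eq hpart huR subset_rfl (Finset.mem_insert_of_mem hAR)]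
      · simpa [excess_comm (A := {u}) (B := A)] using he
      · rintro rfl
        simp at huA

theorem Growable.mem_support_mergeNodesSubset (hCN : C ⊆ G.nodes) (h : Growable γ G C A) :
    blockPartition G.nodes A ∈ (mergeNodesSubset γ θ G (singletonPartition G) C).support := by
  classical
  obtain ⟨L, hL, hLA, hmem⟩ := h.exists_order (θ := θ) hCN
  rw [mergeNodesSubset, PMF.mem_support_bind_iff]
  set F : Finset α := {v ∈ C | WellConnected γ G C {v}} with hF
  have hLF : L.toFinset ⊆ F := fun u hu => by
    rw [List.mem_toFinset] at hu
    exact Finset.mem_filter.2 ⟨h.subset (hLA u hu).1, (hLA u hu).2⟩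
  -- All remaining well-connected nodes are visited after `A` is complete, and each visit may leave
  -- the partition as it is.
  refine ⟨L ++ (F \ L.toFinset).toList, ?_, mem_support_foldlM_append hmem ?_⟩
  · rw [mem_support_uniformOrder]
    refine ⟨?_, ?_⟩
    · rw [List.nodup_append]
      refine ⟨hL, Finset.nodup_toList _, fun a ha b hb => ?_⟩
      rw [Finset.mem_toList, Finset.mem_sdiff, List.mem_toFinset] at hb
      rintro rfl
      exact hb.2 ha
    · rw [List.toFinset_append, Finset.toList_toFinset, Finset.union_sdiff_of_subset hLF]
  · refine mem_support_foldlM_self fun v hv => ?_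
    rw [Finset.mem_toList, Finset.mem_sdiff, hF, Finset.mem_filter] at hv
    exact self_mem_support_mergeNode
      (isPart_blockPartition h.nonempty (h.subset.trans hCN)) hv.1.1 hv.1.2

theorem Growable.mem_support_refinePartition (hP : IsPart G.nodes P) (hC : C ∈ P)
    (h : Growable γ G C A) :
    blockPartition G.nodes A ∈ (refinePartition γ θ G P).support := by
  rw [refinePartition, PMF.mem_support_bind_iff]
  obtain ⟨L, hL⟩ := (uniformOrder P).support_nonempty
  refine ⟨L, hL, ?_⟩
  -- Communities visited before or after `C` may be left unrefined.
  obtain ⟨L₁, L₂, rfl⟩ := List.append_of_mem ((mem_of_mem_uniformOrder hL).2 hC)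
  refine mem_support_foldlM_append
    (mem_support_foldlM_self fun S _ => self_mem_support_mergeNodesSubset (isPart_singletons _)) ?_
  rw [mem_support_foldlM_cons]
  exact ⟨_, h.mem_support_mergeNodesSubset (hP.subset C hC), mem_support_foldlM_self fun S _ =>
    self_mem_support_mergeNodesSubset
      (isPart_blockPartition h.nonempty (h.subset.trans (hP.subset C hC)))⟩

/-- By additivity `excess A T` is the sum of `excess A {u}` over `u ∈ T`, and a nonnegative sum has
a nonnegative term. -/
theorem exists_excess_singleton_nonneg (hT : T.Nonempty) (hd : Disjoint A T)
    (he : 0 ≤ excess γ G A T) : ∃ u ∈ T, 0 ≤ excess γ G A {u} := by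
  by_contra! hcon
  refine absurd he (not_le.2 ?_)
  clear he
  induction hT using Finset.Nonempty.cons_induction with
  | singleton a => exact hcon a (by simp)
  | cons a s ha hs ih =>
    rw [Finset.cons_eq_insert, Finset.insert_eq] at *
    rw [excess_union_right (hd.mono_right Finset.subset_union_left) (by simpa using ha)]
    exact add_neg (hcon a (by simp))
      (ih (hd.mono_right Finset.subset_union_right) fun u hu => hcon u (by simp [hu]))

/-- A set whose nonempty proper subsets are well connected, both in the community and to their
complement in the set, can be built by the refinement phase. -/
theorem growable_of_forall_subset (hS : S.Nonempty) (hSC : S ⊆ C)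
    (hwc : ∀ A ⊂ S, A.Nonempty → WellConnected γ G C A)
    (he : ∀ A ⊂ S, A.Nonempty → 0 ≤ excess γ G A (S \ A)) : Growable γ G C S := by
  -- Growth starts from a singleton, so the size is `n + 1` and the full set is reached at `n = #S -
  -- 1`.
  have key : ∀ n < #S, ∃ A ⊆ S, #A = n + 1 ∧ Growable γ G C A := by
    intro n
    induction n with
    | zero =>
      intro _
      obtain ⟨v, hv⟩ := hS
      exact ⟨{v}, by simpa using hv, by simp, .singleton v (hSC hv)⟩
    | succ n ih =>
      intro hn
      obtain ⟨A, hAS, hcard, hA⟩ := ih (by omega)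
      have hss : A ⊂ S := Finset.ssubset_iff_subset_ne.2 ⟨hAS, by rintro rfl; omega⟩
      obtain ⟨u, hu, hue⟩ := exists_excess_singleton_nonneg
        (Finset.sdiff_nonempty.2 hss.2) Finset.disjoint_sdiff (he A hss hA.nonempty)
      rw [Finset.mem_sdiff] at hu
      have hus : {u} ⊂ S := Finset.ssubset_iff_subset_ne.2
        ⟨by simpa using hu.1, by rintro rfl; simp at hn⟩
      exact ⟨insert u A, Finset.insert_subset hu.1 hAS,
        by rw [Finset.card_insert_of_notMem hu.2, hcard],
        .insert A u hA (hSC hu.1) hu.2 (hwc _ hus (by simp)) (hwc A hss hA.nonempty) hue⟩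
  have hpos := Finset.card_pos.2 hS
  obtain ⟨A, hAS, hcard, hA⟩ := key (#S - 1) (by omega)
  rwa [Finset.eq_of_subset_of_card_le hAS (by omega)] at hA

end Refinement

/-! ### Communities that are not subset optimal -/

section Suboptimal

variable {α : Type u} [DecidableEq α] {γ θ : ℝ} {G : WGraph α} {P : Finset (Finset α)}
  {A C D S : Finset α} {N : Finset α}

theorem wellConnected_iff_gain (hP : IsPart N P) (hC : C ∈ P) (hA : A ⊆ C) :
    WellConnected γ G C A ↔ gain γ G P A ∅ ≤ 0 := by
  have hne : ∅ ≠ C := by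
    rintro rfl
    exact hP.empty_notMem hC
  rw [wellConnected_iff hA, gain_eq hP hC hA (by simp) hne]
  simp

/-- If a subset can be moved with a gain, but none of its proper subsets, then the refinement phase
can build it. -/
theorem growable_of_minimal (hP : IsPart N P) (hC : C ∈ P) (hS : S ⊆ C) (hD : D ∈ insert ∅ P)
    (hgain : 0 < gain γ G P S D)
    (hmin : ∀ A ⊂ S, ∀ D ∈ insert ∅ P, gain γ G P A D ≤ 0) : Growable γ G C S := by
  have hSne : S.Nonempty := by
    rw [Finset.nonempty_iff_ne_empty]
    rintro rfl
    rw [gain_empty hP hD] at hgain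
    exact hgain.false
  have hne : D ≠ C := by
    rintro rfl
    rw [gain_self hP hC hS] at hgain
    exact hgain.false
  refine growable_of_forall_subset hSne hS
    (fun A hA _ => (wellConnected_iff_gain hP hC (hA.1.trans hS)).2 (hmin A hA ∅ (by simp)))
    fun A hA hAne => ?_
  obtain ⟨a, ha⟩ := hAne
  have hB : S \ A ⊂ S := Finset.ssubset_iff_subset_ne.2
    ⟨Finset.sdiff_subset, fun h => (Finset.mem_sdiff.1 (h.symm.subset (hA.1 ha))).2 ha⟩
  -- Additivity gives `gain S = gain A + gain (S \ A) + 2 * excess A (S \ A)`, all gains being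
  -- towards `D`. The left side is positive and the first two terms on the right are not, so the
  -- excess is positive.
  have hgA := hmin A hA D hD
  have hgB := hmin _ hB D hD
  have hAB : Disjoint A (S \ A) := Finset.disjoint_sdiff
  have hSu : A ∪ S \ A = S := Finset.union_sdiff_of_subset hA.1
  have hDS := hP.disjoint_of_subset hC hS hD hne
  have hDA := hDS.mono_right hA.1
  have hDB := hDS.mono_right hB.1
  have hSC : Disjoint S (C \ S) := Finset.disjoint_sdiff
  have hAC := hSC.mono_left hA.1
  have hBC := hSC.mono_left hB.1
  have hCA : C \ A = S \ A ∪ C \ S := by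
    have := hA.1
    ext x
    grind
  have hCB : C \ (S \ A) = A ∪ C \ S := by
    have := hA.1
    ext x
    grind
  rw [gain_eq hP hC (hA.1.trans hS) hD hne, hCA, excess_union_right hAB hBC] at hgA
  rw [gain_eq hP hC (hB.1.trans hS) hD hne, hCB, excess_union_right hAB.symm hAC,
    excess_comm (B := A)] at hgB
  rw [gain_eq hP hC hS hD hne] at hgain
  have e1 : excess γ G S D = excess γ G A D + excess γ G (S \ A) D := by
    rw [← excess_union_left hDA hAB, hSu]
  have e2 : excess γ G S (C \ S) = excess γ G A (C \ S) + excess γ G (S \ A) (C \ S) := by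
    rw [← excess_union_left hAC.symm hAB, hSu]
  linarith

theorem exists_growable_of_not_subsetOptimal (hP : IsPart N P) (hopt : ¬ SubsetOptimal γ G P) :
    ∃ C ∈ P, ∃ S, Growable γ G C S ∧ ∃ D ∈ insert ∅ P, 0 < gain γ G P S D := by
  -- Minimality is over all communities and targets at once, so a proper subset of `S` gains at no
  -- target, `∅` included.
  obtain ⟨S, ⟨C, hC, hS, D, hD, hgain⟩, hmin⟩ :=
    WellFounded.has_min (wellFounded_lt (α := Finset α))
    {S | ∃ C ∈ P, S ⊆ C ∧ ∃ D ∈ insert ∅ P, 0 < gain γ G P S D} (by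
      simp only [SubsetOptimal, not_forall, not_le] at hopt
      obtain ⟨C, hC, S, hS, D, hD, hgain⟩ := hopt
      exact ⟨S, C, hC, hS, D, hD, hgain⟩)
  refine ⟨C, hC, S, growable_of_minimal hP hC hS hD hgain fun A hA D' hD' => ?_, D, hD, hgain⟩
  by_contra hcon
  exact hmin A ⟨C, hC, hA.1.trans hS, D', hD', not_le.1 hcon⟩ hA

/-- Applied to a community with several nodes, this shows that refinement produces something other
than singletons with positive probability. For the whole community the two conditions on proper
subsets coincide. -/
theorem SubsetOptimal.growable (hopt : SubsetOptimal γ G P) (hP : IsPart N P) (hC : C ∈ P) :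
    Growable γ G C C := by
  have hwc : ∀ A ⊆ C, WellConnected γ G C A := fun A hA =>
    (wellConnected_iff_gain hP hC hA).2 (hopt C hC A hA ∅ (by simp))
  exact growable_of_forall_subset (hP.nonempty C hC) subset_rfl (fun A hA _ => hwc A hA.1)
    fun A hA _ => (wellConnected_iff hA.1).1 (hwc A hA.1)

theorem SubsetOptimal.gain_singleton (hopt : SubsetOptimal γ G P) (hP : IsPart N P) :
    ∀ v ∈ N, ∀ D ∈ insert ∅ P, gain γ G P {v} D ≤ 0 := by
  intro v hv D hD
  obtain ⟨C, hC, hvC⟩ := hP.cover v hv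
  exact hopt C hC {v} (by simpa using hvC) D hD

end Suboptimal

/-! ### Rounds of the algorithm -/

section Rounds

variable {V : Type u} [DecidableEq V] {γ θ : ℝ} {B : WGraph V}

/-- The state of the main loop after the partition `P` has been refined to `R`. -/
def nextState (G : WGraph (Finset V)) (P R : Finset (Finset (Finset V))) :
    WGraph (Finset V) × Finset (Finset (Finset V)) :=
  (aggregateGraph G R, P.image fun C => members (aggregateGraph G R) (flatten C))

/-- The current graph is an aggregation of the base graph, and the current partition is a partition
of its nodes. -/
structure ValidState (B : WGraph V) (s : WGraph (Finset V) × Finset (Finset (Finset V))) :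
    Prop where
  represents : Represents B s.1
  isPart : IsPart s.1.nodes s.2

/-- The partition of the base graph that a state stands for. -/
def flatState (s : WGraph (Finset V) × Finset (Finset (Finset V))) : Finset (Finset V) :=
  s.2.image flatten

variable {s : WGraph (Finset V) × Finset (Finset (Finset V))} {G : WGraph (Finset V)}
  {P R : Finset (Finset (Finset V))}

theorem ValidState.isPart_flatState (hs : ValidState B s) : IsPart B.nodes (flatState s) :=
  hs.represents.isPart.image_flatten hs.isPart

theorem ValidState.quality_flatState (hs : ValidState B s) :
    quality γ B (flatState s) = quality γ s.1 s.2 :=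
  (hs.represents.quality_flatten hs.isPart).symm

theorem validState_lift {Q : Finset (Finset V)} (hQ : IsPart B.nodes Q) :
    ValidState B (liftGraph B, liftPartition Q) :=
  ⟨represents_liftGraph B, isPart_liftPartition hQ⟩

theorem flatState_lift {Q : Finset (Finset V)} : flatState (liftGraph B, liftPartition Q) = Q :=
  image_flatten_liftPartition Q

theorem exists_subset_of_refines (hRP : Refines R P) :
    ∀ A ∈ (aggregateGraph G R).nodes, ∃ C ∈ P.image flatten, A ⊆ C := by
  intro A hA
  obtain ⟨X, hX, rfl⟩ := Finset.mem_image.1 hA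
  obtain ⟨C, hC, hXC⟩ := hRP X hX
  exact ⟨_, Finset.mem_image_of_mem _ hC, flatten_mono hXC⟩

theorem nextState_snd :
    (nextState G P R).2 = (P.image flatten).image (members (aggregateGraph G R)) := by
  rw [Finset.image_image]
  rfl

theorem ValidState.nextState (hs : ValidState B (G, P)) (hR : IsPart G.nodes R)
    (hRP : Refines R P) : ValidState B (nextState G P R) := by
  have h := hs.represents.aggregateGraph hR
  refine ⟨h, ?_⟩
  rw [nextState_snd]
  exact isPart_image_members h.isPart hs.isPart_flatState (exists_subset_of_refines hRP)

theorem ValidState.flatState_nextState (hs : ValidState B (G, P)) (hR : IsPart G.nodes R)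
    (hRP : Refines R P) : flatState (Leiden.nextState G P R) = flatState (G, P) := by
  rw [flatState, nextState_snd]
  exact image_flatten_image_members (hs.represents.aggregateGraph hR).isPart hs.isPart_flatState
    (exists_subset_of_refines hRP)

/-- Some node can be moved with a strict gain. -/
def NodeImprovable (γ : ℝ) (s : WGraph (Finset V) × Finset (Finset (Finset V))) : Prop :=
  ∃ v ∈ s.1.nodes, ∃ D ∈ insert ∅ s.2, 0 < gain γ s.1 s.2 {v} D

/-- Both gains equal the same gain in the base graph: aggregation turns the block `S` into one node
and keeps the flattened partition. -/
theorem ValidState.nodeImprovable_nextState (hs : ValidState B (G, P)) (hR : IsPart G.nodes R)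
    (hRP : Refines R P) {C S D : Finset (Finset V)} (hC : C ∈ P) (hS : S ⊆ C) (hSR : S ∈ R)
    (hD : D ∈ insert ∅ P) (hgain : 0 < gain γ G P S D) :
    NodeImprovable γ (Leiden.nextState G P R) := by
  have hs' := hs.nextState hR hRP
  have hflat : (Leiden.nextState G P R).2.image flatten = P.image flatten :=
    hs.flatState_nextState hR hRP
  have hSmem : flatten S ∈ (Leiden.nextState G P R).1.nodes := Finset.mem_image_of_mem _ hSR
  obtain ⟨D', hD', hDD'⟩ := exists_flatten_eq (P := (Leiden.nextState G P R).2)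
    (X := flatten D) (hflat ▸ mem_insert_empty_image_flatten hD)
  obtain ⟨C', hC', hSC'⟩ := hs'.isPart.cover _ hSmem
  refine ⟨flatten S, hSmem, D', hD', ?_⟩
  rwa [hs'.represents.gain_flatten hs'.isPart hC' (by simpa using hSC') hD', hflat,
    flatten_singleton, hDD', ← hs.represents.gain_flatten hs.isPart hC hS hD]

theorem members_congr {G G' : WGraph (Finset V)} (hn : G.nodes = G'.nodes) :
    members G = members G' := by
  unfold members
  rw [hn]

theorem nodes_nextState_singleton :
    (nextState G P (singletonPartition G)).1.nodes = G.nodes := by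
  change (singletonPartition G).image flatten = _
  rw [singletonPartition, Finset.image_image]
  ext A
  simp

theorem edgeWeight_congr {α : Type*} [DecidableEq α] {G G' : WGraph α} (hn : G.nodes = G'.nodes)
    (hw : ∀ u ∈ G.nodes, ∀ v ∈ G.nodes, G.weight s(u, v) = G'.weight s(u, v)) (C D : Finset α) :
    edgeWeight G C D = edgeWeight G' C D := by
  unfold edgeWeight
  rw [← hn]
  refine Finset.sum_congr rfl fun e he => ?_
  have he := (Finset.mem_filter.1 he).1
  induction e using Sym2.ind with
  | _ u v =>
    rw [Finset.mk_mem_sym2_iff] at he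
    exact hw u he.1 v he.2

/-- `Represents` fixes weights and sizes on nodes only, while the functions themselves may differ
elsewhere. Aggregation reads only the values on nodes, which allows literal equality of states after
a second singleton aggregation. -/
theorem aggregateGraph_congr {G G' : WGraph (Finset V)} (hn : G.nodes = G'.nodes)
    (hw : ∀ u ∈ G.nodes, ∀ v ∈ G.nodes, G.weight s(u, v) = G'.weight s(u, v))
    (hsz : ∀ u ∈ G.nodes, G.size u = G'.size u) (R : Finset (Finset (Finset V))) :
    aggregateGraph G R = aggregateGraph G' R := by
  unfold aggregateGraph aggregateBy
  rw [members_congr hn]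
  simp only [edgeWeight_congr hn hw]
  congr 1
  funext A
  refine Finset.sum_congr rfl fun u hu => hsz u ?_
  rw [hn]
  exact (Finset.mem_filter.1 hu).1

/-- Aggregating a graph according to the partition into singletons for a second time does not change
anything. -/
theorem ValidState.nextState_nextState (hs : ValidState B s)
    (hRP : Refines (singletonPartition s.1) s.2) :
    let t := Leiden.nextState s.1 s.2 (singletonPartition s.1)
    Leiden.nextState t.1 t.2 (singletonPartition t.1) = t := by
  intro t
  have hR : IsPart s.1.nodes (singletonPartition s.1) := isPart_singletons _
  have ht : ValidState B t := hs.nextState hR hRP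
  have hn : t.1.nodes = s.1.nodes := nodes_nextState_singleton
  have hsing : singletonPartition t.1 = singletonPartition s.1 := by
    rw [singletonPartition, hn, singletonPartition]
  have hagg : aggregateGraph t.1 (singletonPartition t.1) = t.1 := by
    rw [hsing]
    refine aggregateGraph_congr hn (fun u hu v hv => ?_) (fun u hu => ?_) _
    · rw [ht.represents.weight_eq u hu v hv, hs.represents.weight_eq u (hn ▸ hu) v (hn ▸ hv)]
    · rw [ht.represents.size_eq u hu, hs.represents.size_eq u (hn ▸ hu)]
  refine Prod.ext hagg ?_
  change t.2.image (fun C => members (aggregateGraph t.1 (singletonPartition t.1)) (flatten C)) =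
    t.2
  rw [hagg]
  conv_rhs => rw [← Finset.image_id (s := t.2)]
  exact Finset.image_congr fun C hC =>
    members_flatten ht.represents.isPart (ht.isPart.subset C hC)

variable [Fintype V] {c : Choices γ (Finset V)}

theorem leidenRound_support (hs : ValidState B s)
    {x : (WGraph (Finset V) × Finset (Finset (Finset V))) ⊕ Finset (Finset V)}
    (hx : x ∈ (leidenRound γ θ c s).support) :
    ∃ Q, IsPart B.nodes Q ∧ quality γ B (flatState s) ≤ quality γ B Q ∧
      (NodeImprovable γ s → quality γ B (flatState s) < quality γ B Q) ∧
      (x = Sum.inr Q ∨ ∃ s', x = Sum.inl s' ∧ ValidState B s' ∧ flatState s' = Q) := by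
  rw [leidenRound, PMF.mem_support_bind_iff] at hx
  obtain ⟨P', hP', hx⟩ := hx
  obtain ⟨h1, h2, h3⟩ := moveNodesFast_support hs.isPart hP'
  have hs' : ValidState B (s.1, P') := ⟨hs.represents, h1⟩
  rw [← hs.quality_flatState] at h2 h3
  rw [show quality γ s.1 P' = quality γ B (flatState (s.1, P')) from
    hs'.quality_flatState.symm] at h2 h3
  refine ⟨_, hs'.isPart_flatState, h2, h3, ?_⟩
  split_ifs at hx
  · rw [PMF.mem_support_pure_iff] at hx
    exact Or.inl hx
  · rw [PMF.mem_support_bind_iff] at hx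
    obtain ⟨R, hR, hx⟩ := hx
    obtain ⟨hR, hRP⟩ := refinePartition_support h1 hR
    rw [PMF.mem_support_pure_iff] at hx
    exact Or.inr ⟨_, hx, hs'.nextState hR hRP, hs'.flatState_nextState hR hRP⟩

theorem leidenRounds_support {n : ℕ} {Q : Finset (Finset V)} (hs : ValidState B s)
    (hQ : some Q ∈ (leidenRounds γ θ c n s).support) :
    IsPart B.nodes Q ∧ quality γ B (flatState s) ≤ quality γ B Q ∧
      (NodeImprovable γ s → quality γ B (flatState s) < quality γ B Q) := by
  induction n generalizing s with
  | zero =>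
    rw [leidenRounds, PMF.mem_support_pure_iff] at hQ
    cases hQ
  | succ n ih =>
    rw [leidenRounds, PMF.mem_support_bind_iff] at hQ
    obtain ⟨x, hx, hQ⟩ := hQ
    obtain ⟨Q', h1, h2, h3, rfl | ⟨s', rfl, hs', rfl⟩⟩ := leidenRound_support hs hx
    · rw [Sum.elim_inr, PMF.mem_support_pure_iff, Option.some_inj] at hQ
      subst hQ
      exact ⟨h1, h2, h3⟩
    · obtain ⟨h1', h2', -⟩ := ih hs' hQ
      exact ⟨h1', h2.trans h2', fun h => (h3 h).trans_le h2'⟩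

theorem NodeImprovable.leidenRounds_eq_zero (h : NodeImprovable γ s) (hs : ValidState B s) (n : ℕ) :
    leidenRounds γ θ c n s (some (flatState s)) = 0 := by
  by_contra hne
  exact ((leidenRounds_support hs ((PMF.mem_support_iff _ _).2 hne)).2.2 h).false

/-- One round, when no single node can be moved with a gain. -/
theorem leidenRound_eq (hopt : ∀ v ∈ s.1.nodes, ∀ D ∈ insert ∅ s.2, gain γ s.1 s.2 {v} D ≤ 0)
    (hcard : #s.2 ≠ #s.1.nodes) :
    leidenRound γ θ c s =
      (refinePartition γ θ s.1 s.2).bind fun R => PMF.pure (Sum.inl (nextState s.1 s.2 R)) := by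
  rw [leidenRound, moveNodesFast_eq_pure hopt, PMF.pure_bind, if_neg hcard]
  rfl

theorem leidenRounds_succ_eq
    (hopt : ∀ v ∈ s.1.nodes, ∀ D ∈ insert ∅ s.2, gain γ s.1 s.2 {v} D ≤ 0)
    (hcard : #s.2 ≠ #s.1.nodes) (n : ℕ) (o : Option (Finset (Finset V))) :
    leidenRounds γ θ c (n + 1) s o =
      ∑ R, refinePartition γ θ s.1 s.2 R * leidenRounds γ θ c n (nextState s.1 s.2 R) o := by
  rw [leidenRounds, leidenRound_eq hopt hcard, PMF.bind_bind, PMF.bind_apply, tsum_fintype]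
  simp only [PMF.pure_bind, Sum.elim_inl]

/-! ### Partitions that are not subset optimal are left -/

/-- The bound `q` does not depend on `f`. It is therefore uniform in the number of rounds and
survives the supremum in `leidenMass`. -/
theorem sum_mul_lt_one {ι : Type*} [Fintype ι] (p : PMF ι) {i : ι} (hi : i ∈ p.support) :
    ∃ q < 1, ∀ f : ι → ℝ≥0∞, (∀ j, f j ≤ 1) → f i = 0 → ∑ j, p j * f j ≤ q := by
  classical
  refine ⟨∑ j ∈ univ.erase i, p j, ?_, fun f hf hfi => ?_⟩
  · have h1 : p i + ∑ j ∈ univ.erase i, p j = 1 := by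
      rw [Finset.add_sum_erase _ _ (Finset.mem_univ i), ← tsum_fintype (L := .unconditional _)]
      exact p.tsum_coe
    rw [← h1]
    have hne : ∑ j ∈ univ.erase i, p j ≠ ∞ := fun h => by simp [h] at h1
    rw [add_comm]
    exact ENNReal.lt_add_right hne ((PMF.mem_support_iff _ _).1 hi)
  · rw [← Finset.add_sum_erase _ _ (Finset.mem_univ i), hfi, mul_zero, zero_add]
    exact Finset.sum_le_sum fun j _ => mul_le_of_le_one_right' (hf j)

theorem ValidState.leidenMass_lt_one (hs : ValidState B s) (hopt : ¬ SubsetOptimal γ s.1 s.2) :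
    leidenMass γ θ c s (some (flatState s)) < 1 := by
  by_cases himp : NodeImprovable γ s
  · simp [leidenMass, himp.leidenRounds_eq_zero hs]
  have hnode : ∀ v ∈ s.1.nodes, ∀ D ∈ insert ∅ s.2, gain γ s.1 s.2 {v} D ≤ 0 := by
    intro v hv D hD
    by_contra hcon
    exact himp ⟨v, hv, D, hD, not_le.1 hcon⟩
  obtain ⟨C, hC, S, hS, D, hD, hgain⟩ := exists_growable_of_not_subsetOptimal hs.isPart hopt
  -- The loop cannot stop here: if all communities were single nodes, `S` would itself be an
  -- improvable node.
  have hcard : #s.2 ≠ #s.1.nodes := by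
    intro heq
    obtain ⟨v, rfl⟩ := Finset.card_eq_one.1 (hs.isPart.card_eq_one heq.ge hC)
    have hSv : S = {v} := (Finset.subset_singleton_iff.1 hS.subset).resolve_left
      hS.nonempty.ne_empty
    subst hSv
    exact himp ⟨v, hs.isPart.subset _ hC (by simp), D, hD, hgain⟩
  have hmem := hS.mem_support_refinePartition (θ := θ) hs.isPart hC
  obtain ⟨hR, hRP⟩ := refinePartition_support hs.isPart hmem
  obtain ⟨q, hq, hle⟩ := sum_mul_lt_one _ hmem
  refine lt_of_le_of_lt (iSup_le fun n => ?_) hq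
  rcases n with _ | n
  · simp [leidenRounds]
  · rw [leidenRounds_succ_eq hnode hcard]
    refine hle _ (fun R => PMF.coe_le_one _ _) ?_
    rw [← hs.flatState_nextState hR hRP]
    exact (hs.nodeImprovable_nextState hR hRP hC hS.subset
      (mem_blockPartition.2 (Or.inl rfl)) hD hgain).leidenRounds_eq_zero (hs.nextState hR hRP) n

/-! ### Subset optimal partitions are kept -/

/-- First-step analysis: condition on the refinement, then exchange the finite sum with the limit
over the number of rounds by monotonicity. -/
theorem leidenMass_eq_sum
    (hopt : ∀ v ∈ s.1.nodes, ∀ D ∈ insert ∅ s.2, gain γ s.1 s.2 {v} D ≤ 0)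
    (hcard : #s.2 ≠ #s.1.nodes) (Q : Finset (Finset V)) :
    leidenMass γ θ c s (some Q) =
      ∑ R, refinePartition γ θ s.1 s.2 R * leidenMass γ θ c (nextState s.1 s.2 R) (some Q) := by
  have hmono : ∀ s, Monotone fun n => leidenRounds γ θ c n s (some Q) := fun s =>
    monotone_nat_of_le_succ fun n => leidenRounds_mono γ θ c Q n s
  simp only [leidenMass, ENNReal.mul_iSup]
  rw [ENNReal.finsetSum_iSup_of_monotone
      (f := fun R n => refinePartition γ θ s.1 s.2 R * leidenRounds γ θ c n (nextState s.1 s.2 R)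
        (some Q)) fun R i j hij => mul_le_mul_right (hmono _ hij) _,
    ← (hmono s).iSup_nat_add 1]
  simp only [leidenRounds_succ_eq hopt hcard]

theorem leidenMass_of_card_eq
    (hopt : ∀ v ∈ s.1.nodes, ∀ D ∈ insert ∅ s.2, gain γ s.1 s.2 {v} D ≤ 0)
    (hcard : #s.2 = #s.1.nodes) : leidenMass γ θ c s (some (flatState s)) = 1 := by
  refine le_antisymm (iSup_le fun n => PMF.coe_le_one _ _) (le_iSup_of_le 1 ?_)
  rw [leidenRounds, leidenRound, moveNodesFast_eq_pure hopt, PMF.pure_bind, if_pos hcard,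
    PMF.pure_bind, Sum.elim_inr, flatState, PMF.pure_apply_self]

theorem ValidState.leidenMass_eq_one (hs : ValidState B s)
    (hopt : SubsetOptimal γ B (flatState s)) :
    leidenMass γ θ c s (some (flatState s)) = 1 := by
  obtain ⟨k, hk⟩ : ∃ k, #s.1.nodes = k := ⟨_, rfl⟩
  induction k using Nat.strong_induction_on generalizing s with
  | _ k ih =>
  have hnode : ∀ {s}, ValidState B s → SubsetOptimal γ B (flatState s) →
      ∀ v ∈ s.1.nodes, ∀ D ∈ insert ∅ s.2, gain γ s.1 s.2 {v} D ≤ 0 := fun hs hopt =>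
    (hs.represents.subsetOptimal hs.isPart hopt).gain_singleton hs.isPart
  -- the mass of `s` is an average of `1` and of the mass of the state with the same nodes
  have step : ∀ {s}, ValidState B s → SubsetOptimal γ B (flatState s) → #s.1.nodes = k →
      ∀ m : ℝ≥0∞, (Refines (singletonPartition s.1) s.2 →
        leidenMass γ θ c (Leiden.nextState s.1 s.2 (singletonPartition s.1))
          (some (flatState s)) = m) →
      leidenMass γ θ c s (some (flatState s)) = 1 ∨
      ∃ p q : ℝ≥0∞, p ≠ 0 ∧ p + q = 1 ∧
        leidenMass γ θ c s (some (flatState s)) = p + q * m := by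
    intro s hs hopt hk m hm
    have hnode := hnode hs hopt
    by_cases hcard : #s.2 = #s.1.nodes
    · exact Or.inl (leidenMass_of_card_eq hnode hcard)
    -- Here `q` is the probability that refinement leaves all singletons, and `p` that of all other
    -- outcomes. The latter shrink the graph, so by induction their mass is one.
    refine Or.inr ⟨∑ R ∈ univ.erase (singletonPartition s.1), refinePartition γ θ s.1 s.2 R,
      refinePartition γ θ s.1 s.2 (singletonPartition s.1), ?_, ?_, ?_⟩
    · obtain ⟨C, hC, hC1⟩ := hs.isPart.exists_one_lt_card
        (lt_of_le_of_ne hs.isPart.card_le hcard)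
      have hmem := ((hs.represents.subsetOptimal hs.isPart hopt).growable hs.isPart
        hC).mem_support_refinePartition (θ := θ) hs.isPart hC
      intro h0
      rw [Finset.sum_eq_zero_iff] at h0
      refine (PMF.mem_support_iff _ _).1 hmem (h0 _ (Finset.mem_erase.2 ⟨fun heq => ?_, by simp⟩))
      have hCmem : C ∈ singletonPartition s.1 := heq ▸ mem_blockPartition.2 (Or.inl rfl)
      obtain ⟨v, -, rfl⟩ := Finset.mem_image.1 hCmem
      simp at hC1
    · rw [Finset.sum_erase_add _ _ (Finset.mem_univ _), ← tsum_fintype (L := .unconditional _)]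
      exact PMF.tsum_coe _
    · rw [leidenMass_eq_sum hnode hcard, ← Finset.sum_erase_add _ _
        (Finset.mem_univ (singletonPartition s.1))]
      congr 1
      · refine Finset.sum_congr rfl fun R hR => ?_
        by_cases hsupp : R ∈ (refinePartition γ θ s.1 s.2).support
        · obtain ⟨hRpart, hRP⟩ := refinePartition_support hs.isPart hsupp
          have hflat := hs.flatState_nextState hRpart hRP
          have hlt : #(Leiden.nextState s.1 s.2 R).1.nodes < k := by
            change #(R.image flatten) < k
            rw [card_image_flatten hs.represents.isPart hRpart, ← hk]
            by_contra hge
            exact (Finset.mem_erase.1 hR).1 (hRpart.eq_singletons (not_lt.1 hge))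
          have := ih _ hlt (hs.nextState hRpart hRP) (by rwa [hflat]) rfl
          rw [hflat] at this
          rw [this, mul_one]
        · rw [PMF.mem_support_iff, not_not] at hsupp
          rw [hsupp, zero_mul]
      · by_cases hsupp : singletonPartition s.1 ∈ (refinePartition γ θ s.1 s.2).support
        · rw [hm (refinePartition_support hs.isPart hsupp).2]
        · rw [PMF.mem_support_iff, not_not] at hsupp
          rw [hsupp, zero_mul, zero_mul]
  by_cases hRP : Refines (singletonPartition s.1) s.2
  · have hR : IsPart s.1.nodes (singletonPartition s.1) := isPart_singletons _
    have hflat := hs.flatState_nextState hR hRP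
    have hfix := hs.nextState_nextState hRP
    set t := Leiden.nextState s.1 s.2 (singletonPartition s.1) with ht
    have htm : leidenMass γ θ c t (some (flatState t)) = 1 := by
      have hle : leidenMass γ θ c t (some (flatState t)) ≤ 1 :=
        iSup_le fun n => PMF.coe_le_one _ _
      -- The state `t` is its own successor under singleton refinement, so its mass satisfies `m = p
      -- + q * m`. The original `s` need not be such a fixed point.
      rcases step (s := t) (hs.nextState hR hRP) (by rwa [hflat])
        (by rw [ht, nodes_nextState_singleton, hk]) _ (fun _ => by rw [hfix])
        with h | ⟨p, q, hp, hpq, h⟩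
      · exact h
      set m := leidenMass γ θ c t (some (flatState t))
      have hpt : p ≠ ∞ := fun h' => by simp [h'] at hpq
      have hqm : q * m ≠ ∞ := ne_top_of_le_ne_top ENNReal.one_ne_top
        (mul_le_one' (hpq ▸ le_add_self) hle)
      -- Since `p + q = 1`, cancelling the finite term `q * m` leaves `p * m = p`, and `p` is
      -- neither zero nor infinite.
      have h2 : p * m + q * m = p + q * m := by rw [← add_mul, hpq, one_mul, ← h]
      have h3 := (ENNReal.add_left_inj hqm).1 h2
      exact (ENNReal.mul_right_inj hp hpt).1 (by rw [h3, mul_one])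
    rw [hflat] at htm
    rcases step hs hopt hk 1 (fun _ => htm) with h | ⟨p, q, -, hpq, h⟩
    · exact h
    · rw [h, mul_one, hpq]
  · rcases step hs hopt hk 1 (fun h => absurd h hRP) with h | ⟨p, q, -, hpq, h⟩
    · exact h
    · rw [h, mul_one, hpq]

/-! ### One iteration of the algorithm -/

theorem leiden_apply_self {Q : Finset (Finset V)} (hQ : IsPart B.nodes Q)
    (hopt : SubsetOptimal γ B Q) : leiden γ θ c B Q (some Q) = 1 := by
  have h := (validState_lift hQ).leidenMass_eq_one (θ := θ) (c := c) (by rwa [flatState_lift])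
  rwa [flatState_lift] at h

/-- On the lifted graph every base set is a set of nodes, so there optimality also passes back to
the base graph. -/
theorem leiden_lt_one {Q : Finset (Finset V)} (hQ : IsPart B.nodes Q)
    (hopt : ¬ SubsetOptimal γ B Q) : leiden γ θ c B Q (some Q) < 1 := by
  have h := (validState_lift hQ).leidenMass_lt_one (γ := γ) (θ := θ) (c := c) fun h => hopt ?_
  · rwa [flatState_lift] at h
  · intro C hC S hS D hD
    have hs := validState_lift hQ
    have hflat : (liftPartition Q).image flatten = Q := flatState_lift (B := B)
    obtain ⟨D', hD', rfl⟩ := exists_flatten_eq (P := liftPartition Q) (hflat.symm ▸ hD)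
    have := h _ (Finset.mem_image_of_mem _ hC) _
      (Finset.image_subset_image (f := fun v => ({v} : Finset V)) hS) D' hD'
    rwa [hs.represents.gain_flatten hs.isPart (Finset.mem_image_of_mem _ hC)
      (Finset.image_subset_image hS) hD', hflat, flatten_image_singleton] at this

theorem isPart_of_mem_support_leiden {Q Q' : Finset (Finset V)} (hQ : IsPart B.nodes Q)
    (hQ' : some Q' ∈ (leiden γ θ c B Q).support) : IsPart B.nodes Q' := by
  have h : leidenMass γ θ c (liftGraph B, liftPartition Q) (some Q') ≠ 0 := hQ'
  simp only [leidenMass, ne_eq, ENNReal.iSup_eq_zero, not_forall] at h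
  obtain ⟨n, hn⟩ := h
  exact (leidenRounds_support (validState_lift hQ) ((PMF.mem_support_iff _ _).2 hn)).1

end Rounds

/-! ### Homogeneous Markov chains on a finite state space -/

section MarkovChain

variable {E : Type u} [Finite E] [MeasurableSpace E] [DiscreteMeasurableSpace E]

/-- The law of the Markov chain with transition kernel `K`, started from `x`. -/
def chainLaw (K : Kernel E E) [IsMarkovKernel K] (x : E) : Measure (ℕ → E) :=
  Kernel.trajMeasure (X := fun _ => E) (Measure.dirac x) fun n =>
    K.comap (fun h => h ⟨n, Finset.mem_Iic.2 le_rfl⟩) (measurable_pi_apply _)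

variable {K : Kernel E E} [IsMarkovKernel K] {x : E}

instance : IsProbabilityMeasure (chainLaw K x) := by
  unfold chainLaw
  infer_instance

theorem chainLaw_zero : ∀ᵐ X ∂(chainLaw K x), X 0 = x := by
  have h : (chainLaw K x).map (Preorder.frestrictLe (π := fun _ => E) 0)
      = (Measure.dirac x).map (MeasurableEquiv.piUnique fun _ : Finset.Iic 0 => E).symm := by
    rw [chainLaw, Kernel.trajMeasure, Measure.map_comp _ _ (by fun_prop),
      Kernel.traj_map_frestrictLe, Kernel.partialTraj_self, Measure.id_comp]
  rw [Measure.map_dirac' (by fun_prop)] at h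
  have h2 : ∀ᵐ y ∂((chainLaw K x).map (Preorder.frestrictLe (π := fun _ => E) 0)),
      y ⟨0, Finset.mem_Iic.2 le_rfl⟩ = x := by
    rw [h, ae_dirac_iff (Set.toFinite _).measurableSet]
    rfl
  exact ae_of_ae_map (by fun_prop) h2

/-- The joint law of the history up to `n` and the next state is the composition product of the
history's law with `K`. The event is then an integral over `A` of a quantity at most `p`. -/
theorem chainLaw_step_le {n : ℕ} {A : Set ((i : Finset.Iic n) → E)} {S : Set E} {p : ℝ≥0∞}
    (h : ∀ y ∈ A, K (y ⟨n, Finset.mem_Iic.2 le_rfl⟩) S ≤ p) :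
    chainLaw K x {X | Preorder.frestrictLe (π := fun _ => E) n X ∈ A ∧ X (n + 1) ∈ S} ≤
      p * chainLaw K x {X | Preorder.frestrictLe (π := fun _ => E) n X ∈ A} := by
  have hA : MeasurableSet A := (Set.toFinite _).measurableSet
  have hS : MeasurableSet S := .of_discrete
  have hm := Kernel.map_frestrictLe_trajMeasure_compProd_eq_map_trajMeasure
    (X := fun _ => E) (μ₀ := Measure.dirac x)
    (κ := fun n => K.comap (fun h => h ⟨n, Finset.mem_Iic.2 le_rfl⟩) (measurable_pi_apply _))
    (a := n)
  have hm2 := congrArg (fun μ => μ (A ×ˢ S)) hm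
  beta_reduce at hm2
  rw [Measure.compProd_apply_prod hA hS, Measure.map_apply (by fun_prop) (hA.prod hS)] at hm2
  change chainLaw K x ((fun X => (Preorder.frestrictLe n X, X (n + 1))) ⁻¹' A ×ˢ S) ≤ _
  refine hm2.symm.le.trans ((setLIntegral_mono measurable_const fun y hy => h y hy).trans ?_)
  rw [setLIntegral_const, Measure.map_apply (by fun_prop) hA]
  rfl

theorem chainLaw_step {a : E} {S : Set E} (h : K a Sᶜ = 0) (n : ℕ) :
    ∀ᵐ X ∂(chainLaw K x), X n = a → X (n + 1) ∈ S := by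
  have hle := chainLaw_step_le (K := K) (x := x) (n := n) (S := Sᶜ) (p := 0)
    (A := {y | y ⟨n, Finset.mem_Iic.2 le_rfl⟩ = a}) (by
      rintro y rfl
      exact h.le)
  rw [zero_mul, nonpos_iff_eq_zero] at hle
  rw [ae_iff]
  refine measure_mono_null (fun X hX => ?_) hle
  simp only [Set.mem_ofPred_eq, Classical.not_imp] at hX
  exact hX

/-- Staying at `a` from time `m` to `m + n` takes `n` transitions, so it has probability at most `K
a {a} ^ n`, which tends to zero. -/
theorem chainLaw_leave {a : E} (h : K a {a} < 1) (m : ℕ) :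
    ∀ᵐ X ∂(chainLaw K x), ¬ ∀ t ≥ m, X t = a := by
  have hle : ∀ n, chainLaw K x {X | ∀ t, m ≤ t → t ≤ m + n → X t = a} ≤ K a {a} ^ n := by
    intro n
    induction n with
    | zero => simpa using prob_le_one
    | succ n ih =>
      have hstep := chainLaw_step_le (K := K) (x := x) (n := m + n) (S := {a}) (p := K a {a})
        (A := {y | ∀ i : Finset.Iic (m + n), m ≤ i.1 → y i = a}) (by
          intro y hy
          rw [hy _ (Nat.le_add_right m n)])
      rw [pow_succ']
      refine (measure_mono fun X hX => ?_).trans (hstep.trans ?_)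
      · exact ⟨fun i hi => hX i.1 hi ((Finset.mem_Iic.1 i.2).trans (by omega)),
          hX (m + n + 1) (by omega) (by omega)⟩
      · refine mul_le_mul_right ((measure_mono fun X hX => ?_).trans ih) _
        exact fun t ht ht' => hX ⟨t, Finset.mem_Iic.2 ht'⟩ ht
  rw [ae_iff]
  refine le_antisymm (ge_of_tendsto' (ENNReal.tendsto_pow_atTop_nhds_zero_of_lt_one h) fun n =>
    (measure_mono fun X hX => ?_).trans (hle n)) zero_le
  simp only [Set.mem_ofPred_eq, not_not] at hX
  exact fun t ht _ => hX t ht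

end MarkovChain

/-! ### Iterating the Leiden algorithm -/

section Iteration

variable {V : Type u} [DecidableEq V] [Fintype V] {γ θ : ℝ} {c : Choices γ (Finset V)}
  {G : WGraph V} {P : Finset (Finset V)}

theorem leidenKernel_some (Q : Finset (Finset V)) :
    leidenKernel γ θ c G (some Q) = (leiden γ θ c G Q).toMeasure := rfl

theorem leidenSequence_isPart (hP : IsPart G.nodes P) :
    ∀ᵐ X ∂(leidenSequence γ θ c G P), ∀ (t : ℕ) (Q : Finset (Finset V)), X t = some Q →
      IsPart G.nodes Q := by
  -- The outcome `none` satisfies the condition vacuously and is absorbing. Only transitions out of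
  -- genuine partitions need an argument.
  have hstep : ∀ᵐ X ∂(leidenSequence γ θ c G P), ∀ (o : Outcome V),
      (∀ Q, o = some Q → IsPart G.nodes Q) → ∀ n, X n = o →
        X (n + 1) ∈ {o' : Outcome V | ∀ Q, o' = some Q → IsPart G.nodes Q} := by
    rw [ae_all_iff]
    intro o
    by_cases ho : ∀ Q, o = some Q → IsPart G.nodes Q
    · suffices h : ∀ᵐ X ∂(leidenSequence γ θ c G P), ∀ n, X n = o →
          X (n + 1) ∈ {o' : Outcome V | ∀ Q, o' = some Q → IsPart G.nodes Q} from
        h.mono fun X hX _ => hX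
      rw [ae_all_iff]
      refine chainLaw_step ?_
      rcases o with _ | Q
      · change (PMF.pure none).toMeasure _ = 0
        rw [PMF.toMeasure_apply_eq_zero_iff _ .of_discrete]
        simp
      · rw [leidenKernel_some, PMF.toMeasure_apply_eq_zero_iff _ .of_discrete,
          Set.disjoint_compl_right_iff_subset]
        rintro o' ho' Q' rfl
        exact isPart_of_mem_support_leiden (ho Q rfl) ho'
    · exact Filter.Eventually.of_forall fun _ h => absurd h ho
  filter_upwards [hstep, chainLaw_zero (K := leidenKernel γ θ c G) (x := some P)] with X hX h0 t
  induction t with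
  | zero =>
    intro Q hQ
    rw [h0, Option.some_inj] at hQ
    exact hQ ▸ hP
  | succ t ih => exact hX _ ih t rfl

theorem leidenSequence_stable_iff (hP : IsPart G.nodes P) :
    ∀ᵐ X ∂(leidenSequence γ θ c G P), ∀ (τ : ℕ) (Q : Finset (Finset V)), X τ = some Q →
      ((∀ t ≥ τ, X t = some Q) ↔ SubsetOptimal γ G Q) := by
  have hkeep : ∀ᵐ X ∂(leidenSequence γ θ c G P), ∀ Q, IsPart G.nodes Q → SubsetOptimal γ G Q →
      ∀ n, X n = some Q → X (n + 1) ∈ ({some Q} : Set (Outcome V)) := by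
    rw [ae_all_iff]
    intro Q
    by_cases hQ : IsPart G.nodes Q ∧ SubsetOptimal γ G Q
    · simp only [hQ.1, hQ.2, true_imp_iff]
      rw [ae_all_iff]
      refine chainLaw_step ?_
      rw [leidenKernel_some, prob_compl_eq_zero_iff .of_discrete,
        PMF.toMeasure_apply_singleton _ _ .of_discrete]
      exact leiden_apply_self hQ.1 hQ.2
    · exact Filter.Eventually.of_forall fun _ h h' => absurd ⟨h, h'⟩ hQ
  have hleave : ∀ᵐ X ∂(leidenSequence γ θ c G P), ∀ Q, IsPart G.nodes Q → ¬ SubsetOptimal γ G Q →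
      ∀ τ, ¬ ∀ t ≥ τ, X t = some Q := by
    rw [ae_all_iff]
    intro Q
    by_cases hQ : IsPart G.nodes Q ∧ ¬ SubsetOptimal γ G Q
    · simp only [hQ.1, hQ.2, true_imp_iff, not_false_eq_true]
      rw [ae_all_iff]
      refine chainLaw_leave ?_
      rw [leidenKernel_some, PMF.toMeasure_apply_singleton _ _ .of_discrete]
      exact leiden_lt_one hQ.1 hQ.2
    · exact Filter.Eventually.of_forall fun _ h h' => absurd ⟨h, h'⟩ hQ
  filter_upwards [hkeep, hleave, leidenSequence_isPart hP] with X h1 h2 h3 τ Q hQ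
  have hpart := h3 τ Q hQ
  constructor
  · intro h
    by_contra hopt
    exact h2 Q hpart hopt τ h
  · intro hopt t ht
    induction t, ht using Nat.le_induction with
    | base => exact hQ
    | succ t _ ih => exact h1 Q hpart hopt t ih

/-- This is the pathwise statement at `τ = 0`. Stability yields optimality because a probability
measure has a path outside all the null sets. -/
theorem asymptoticallyStable_iff (hP : IsPart G.nodes P) :
    AsymptoticallyStable γ θ c G P ↔ SubsetOptimal γ G P := by
  have h0 : ∀ᵐ X ∂(leidenSequence γ θ c G P), X 0 = some P := chainLaw_zero
  have h := leidenSequence_stable_iff (θ := θ) (c := c) hP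
  constructor
  · intro hst
    have : IsProbabilityMeasure (leidenSequence γ θ c G P) :=
      inferInstanceAs (IsProbabilityMeasure (chainLaw (leidenKernel γ θ c G) (some P)))
    obtain ⟨X, hX0, hX, hXst⟩ := (h0.and (h.and hst)).exists
    exact (hX 0 P hX0).1 fun t _ => hXst t
  · intro hopt
    filter_upwards [h0, h] with X hX0 hX t
    exact (hX 0 P hX0).2 hopt t t.zero_le

end Iteration

/-! ### The theorem for `Finpartition` -/

theorem isPart_finpartition {V : Type u} [DecidableEq V] {N : Finset V}
    (P : Finpartition N) : IsPart N P.parts where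
  nonempty _ hC := P.nonempty_of_mem_parts hC
  subset _ hC := P.le hC
  cover _ hv := P.exists_mem hv
  eq_of_mem _ hC _ hD _ hvC hvD := P.eq_of_mem_parts hC hD hvC hvD

end Leiden
end

theorem mainTheorem1 {V : Type*} [Fintype V] [DecidableEq V]
    (w : Sym2 V → ℝ) (hw : ∀ e, 0 ≤ w e) (γ θ : ℝ) (hγ : 0 < γ) (hθ : 0 < θ)
    (c : Leiden.Choices γ (Finset V)) (P : Finpartition (Finset.univ : Finset V)) :
    (Leiden.AsymptoticallyStable γ θ c (Leiden.baseGraph w) P.parts ↔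
      Leiden.SubsetOptimal γ (Leiden.baseGraph w) P.parts) ∧
    ∀ᵐ X ∂(Leiden.leidenSequence γ θ c (Leiden.baseGraph w) P.parts),
      ∀ (τ : ℕ) (Q : Finset (Finset V)), X τ = some Q →
        ((∀ t ≥ τ, X t = some Q) ↔ Leiden.SubsetOptimal γ (Leiden.baseGraph w) Q) := by
  have hP : Leiden.IsPart (Leiden.baseGraph w).nodes P.parts := Leiden.isPart_finpartition P
  exact ⟨Leiden.asymptoticallyStable_iff hP, Leiden.leidenSequence_stable_iff hP⟩
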